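/- Let $\nu,\eta>0$, $m=\min(\nu,\eta)$, and let $f_1,f_2\in L^\infty_{loc}([0,\infty);H^{-1}(\mathbb R^3)\cap L^2(\mathbb R^3))$ be divergence-free. Let $L^2_\sigma$, $H^1_\sigma$ be the closures in $L^2$, $H^1$ of the smooth, compactly supported, divergence-free vector fields on $\mathbb R^3$, let $u_0,b_0\in L^2_\sigma$, and let $(u,b)$ be a weak solution on $\mathbb R^3\times[0,\infty)$ of the MHD system $$\partial_tu+(u\cdot\nabla)u+\nabla\pi-(b\cdot\nabla)b-\nu\Delta u=f_1,\qquad \partial_tb+(u\cdot\nabla)b-(b\cdot\nabla)u-\eta\Delta b=f_2,\qquad \mathrm{div}\,u=\mathrm{div}\,b=0,$$ with initial data $(u_0,b_0)$. This means: $u,b\in L^\infty([0,T);L^2_\sigma)\cap L^2([0,T);H^1_\sigma)$ for every $T>0$; for every $T>0$ and all $\Phi,\Psi\in H^1((0,T);H^1_\sigma)$ with $\Phi(T)=\Psi(T)=0$, $$\int_0^T\{-(u,\partial_t\Phi)+\nu(\nabla u,\nabla\Phi)+(u\cdot\nabla u,\Phi)-(b\cdot\nabla b,\Phi)\}\,dt=(u_0,\Phi(0))+\int_0^T(f_1,\Phi)\,dt,$$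 $$\int_0^T\{-(b,\partial_t\Psi)+\eta(\nabla b,\nabla\Psi)+(u\cdot\nabla b,\Psi)-(b\cdot\nabla u,\Psi)\}\,dt=(b_0,\Psi(0))+\int_0^T(f_2,\Psi)\,dt;$$ $u(\cdot,t)\to u_0$ and $b(\cdot,t)\to b_0$ strongly in $L^2$ as $t\to0^+$; and for all $t>0$ $$\tfrac12\big(\|u(t)\|_{L^2}^2+\|b(t)\|_{L^2}^2\big)+m\int_0^t\big(\|\nabla u\|_{L^2}^2+\|\nabla b\|_{L^2}^2\big)ds-\int_0^t\big((u,f_1)+(b,f_2)\big)ds\le\tfrac12\big(\|u_0\|_{L^2}^2+\|b_0\|_{L^2}^2\big).$$ Let $R:[0,\infty)\to[0,\infty)$ be a nondecreasing function with $\|u_0\|_{L^2}^2+\|b_0\|_{L^2}^2\le R^2(0)$ and, for all $T>0$, $$\|u(T)\|_{L^2}^2+\|b(T)\|_{L^2}^2+m\int_0^T\big(\|\nabla u\|_{L^2}^2+\|\nabla b\|_{L^2}^2\big)ds\le R^2(T).$$ Write $\widehat v(\xi)=\int e^{-i\xi\cdot x}v(x)\,dx$ for the Fourier transform (extended to $L^2$).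 For each $\kappa\in\mathbb R^3\setminus\{0\}$ let $0<\delta_\kappa<|\kappa|/(2\sqrt3)$ and let $\widehat\chi_\kappa\in C^\infty(\mathbb R^3;[0,1])$ equal $1$ on the cube of side $\delta_\kappa$ about $\kappa$ and be supported in the cube of side $2\delta_\kappa$ about $\kappa$. Put $$e_p(\kappa,0)=\Big(\int|\widehat\chi_\kappa\widehat u_0|^p+|\widehat\chi_\kappa\widehat b_0|^p\,d\xi\Big)^{1/p},\qquad F_\infty(T)=\sup_{\kappa\ne0}\Big(\int_0^T\|\widehat\chi_\kappa\widehat f_1(t)\|_{L^\infty}^2+\|\widehat\chi_\kappa\widehat f_2(t)\|_{L^\infty}^2\,dt\Big)^{1/2}.$$ Let $k>0$ and let $R_1(0)$ be a number such that $\sup_{2\le p<\infty}e_p(\kappa,0)<R_1(0)/k$ for every $\kappa\in\mathbb R^3$ with $|\kappa|=k$. For $T>0$ with $F_\infty(T)<\infty$ put $$R_3(T)=\frac{2R^2(T)}{m}+\frac{2F_\infty(T)}{\sqrt m},\qquad R_2(T)=\tfrac12\Big(R_3(T)+\sqrt{4R_1^2(0)+R_3^2(T)}\Big).$$ Let $E(k,t)=\int_{|\xi|=k}\big(|\widehat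 u(\xi,t)|^2+|\widehat b(\xi,t)|^2\big)\,dS(\xi)$ be the spectral energy, where the values of $\widehat u(\cdot,t),\widehat b(\cdot,t)\in L^2$ on the sphere are those of the precise representative (the limit of averages over shrinking balls where it exists, $0$ elsewhere). Then for every such $T$ the function $E(k,\cdot)$ is measurable on $(0,T)$ and $$\frac1T\int_0^TE(k,t)\,dt\le\frac{4\pi R_2^2(T)}{\min(\nu,\eta)\,T\,k^2}.$$ -/

import Mathlib

open MeasureTheory Set Filter Topology
open scoped ENNReal ContDiff FourierTransform

noncomputable section

namespace MHD

/-! ### Function spaces of divergence-free fields on the whole space -/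

/-- The spatial domain `D = ℝ³`, with the Euclidean norm. -/
abbrev R3 : Type := EuclideanSpace ℝ (Fin 3)

/-- `ℂ³`, with the Hermitian norm. -/
abbrev C3 : Type := EuclideanSpace ℂ (Fin 3)

/-- Square-integrable vector fields on `ℝ³`. -/
abbrev L2 : Type := Lp R3 2 (volume : Measure R3)

/-- The classical partial derivative `∂_j φ`. -/
def pderiv (j : Fin 3) (φ : R3 → R3) (x : R3) : R3 :=
  fderiv ℝ φ x (EuclideanSpace.single j 1)

/-- `C_{0,σ}^∞`: smooth, compactly supported, divergence-free vector fields. -/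
def testFields : Set (R3 → R3) :=
  {φ | ContDiff ℝ ∞ φ ∧ HasCompactSupport φ ∧ ∀ x, ∑ j, (pderiv j φ x) j = 0}

/-- `L²_σ`: the closure of `C_{0,σ}^∞` in `L²`. -/
def L2sigma : Set L2 :=
  closure {v | ∃ φ ∈ testFields, (v : R3 → R3) =ᵐ[volume] φ}

/-- The graph of the gradient on `H¹_σ`: limits in `L²` of the pairs `(φ, ∇φ)`, `φ ∈ C_{0,σ}^∞`.
A gradient is recorded as the family of its three partial derivatives. -/
def gradGraph : Set (L2 × (Fin 3 → L2)) :=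
  closure {p | ∃ φ ∈ testFields, (p.1 : R3 → R3) =ᵐ[volume] φ ∧
    ∀ j, (p.2 j : R3 → R3) =ᵐ[volume] pderiv j φ}

/-- `H¹_σ`: the closure of `C_{0,σ}^∞` in the `H¹` norm. -/
def H1sigma : Set L2 := {v | ∃ g, (v, g) ∈ gradGraph}

open Classical in
/-- The weak gradient `(∂₁v, ∂₂v, ∂₃v)` of `v ∈ H¹_σ` (and `0` for other `v`). -/
def weakGrad (v : L2) : Fin 3 → L2 :=
  if h : ∃ g, (v, g) ∈ gradGraph then h.choose else 0

/-- `‖∇v‖²_{L²} = ∑_j ‖∂_j v‖²_{L²}`. -/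
def gradNormSq (v : L2) : ℝ := ∑ j, ‖weakGrad v j‖ ^ 2

/-- `(∇v, ∇w)`, the `L²` inner product of the gradients. -/
def gradInner (v w : L2) : ℝ := ∑ j, inner ℝ (weakGrad v j) (weakGrad w j)

/-- The convection form `(v·∇w, φ) = ∫ ∑_j v_j ∂_j w · φ dx`. -/
def convection (v w φ : L2) : ℝ :=
  ∫ x, ∑ j, (v x) j * inner ℝ (weakGrad w j x) (φ x)

/-- `v ∈ L²([0,T); H¹_σ)`. -/
def IsL2H1 (T : ℝ) (v : ℝ → L2) : Prop :=
  MemLp v 2 (volume.restrict (Ioo 0 T)) ∧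
  (∀ᵐ t ∂(volume.restrict (Ioo 0 T)), v t ∈ H1sigma) ∧
  ∀ j, MemLp (fun t => weakGrad (v t) j) 2 (volume.restrict (Ioo 0 T))

/-- `v ∈ L^∞([0,T); L²_σ)`. -/
def IsLinftyL2 (T : ℝ) (v : ℝ → L2) : Prop :=
  MemLp v ∞ (volume.restrict (Ioo 0 T)) ∧
  ∀ᵐ t ∂(volume.restrict (Ioo 0 T)), v t ∈ L2sigma

/-- Divergence-free forces in `L^∞_loc([0,∞); H⁻¹ ∩ L²)`. Here `H⁻¹ ∩ L² = L²` with equivalent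
norms, since `‖·‖_{H⁻¹} ≤ ‖·‖_{L²}`. -/
def IsForce (f : ℝ → L2) : Prop := ∀ T > 0, IsLinftyL2 T f

/-- `Φ ∈ H¹((0,T); H¹_σ)` with time derivative `∂_t Φ = φ` and `Φ(T) = 0`; such a `Φ` is the
primitive, vanishing at `T`, of a `φ ∈ L²((0,T); H¹_σ)`. -/
def IsTest (T : ℝ) (Φ φ : ℝ → L2) : Prop :=
  IsL2H1 T φ ∧ ∀ t ∈ Icc 0 T, Φ t = - ∫ s in t..T, φ s

/-- Weak (Leray) solutions `(u, b)` of the incompressible MHD system on `ℝ³`, with viscosity `ν`,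
resistivity `η`, forces `f₁, f₂` and initial data `u₀, b₀`. -/
structure IsWeakSolution (ν η : ℝ) (f₁ f₂ : ℝ → L2) (u₀ b₀ : L2) (u b : ℝ → L2) : Prop where
  u₀_mem : u₀ ∈ L2sigma
  b₀_mem : b₀ ∈ L2sigma
  u_bdd : ∀ T > 0, IsLinftyL2 T u
  b_bdd : ∀ T > 0, IsLinftyL2 T b
  u_H1 : ∀ T > 0, IsL2H1 T u
  b_H1 : ∀ T > 0, IsL2H1 T b
  momentum : ∀ T > 0, ∀ Φ φ : ℝ → L2, IsTest T Φ φ →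
    ∫ t in (0 : ℝ)..T, (- inner ℝ (u t) (φ t) + ν * gradInner (u t) (Φ t)
        + convection (u t) (u t) (Φ t) - convection (b t) (b t) (Φ t)) =
      inner ℝ u₀ (Φ 0) + ∫ t in (0 : ℝ)..T, inner ℝ (f₁ t) (Φ t)
  induction_eq : ∀ T > 0, ∀ Ψ ψ : ℝ → L2, IsTest T Ψ ψ →
    ∫ t in (0 : ℝ)..T, (- inner ℝ (b t) (ψ t) + η * gradInner (b t) (Ψ t)
        + convection (u t) (b t) (Ψ t) - convection (b t) (u t) (Ψ t)) =
      inner ℝ b₀ (Ψ 0) + ∫ t in (0 : ℝ)..T, inner ℝ (f₂ t) (Ψ t)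
  u_init : Tendsto u (𝓝[>] 0) (𝓝 u₀)
  b_init : Tendsto b (𝓝[>] 0) (𝓝 b₀)
  energy : ∀ t > 0,
    (1 / 2) * (‖u t‖ ^ 2 + ‖b t‖ ^ 2)
      + min ν η * (∫ s in (0 : ℝ)..t, (gradNormSq (u s) + gradNormSq (b s)))
      - (∫ s in (0 : ℝ)..t, (inner ℝ (u s) (f₁ s) + inner ℝ (b s) (f₂ s)))
      ≤ (1 / 2) * (‖u₀‖ ^ 2 + ‖b₀‖ ^ 2)

/-! ### Fourier transform and spectral energy -/

/-- The inclusion `ℝ³ → ℂ³`. -/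
def complexify : R3 →L[ℝ] C3 :=
  LinearMap.toContinuousLinearMap
    { toFun := fun v => WithLp.toLp 2 fun i => (v i : ℂ)
      map_add' := fun v w => by ext i; simp
      map_smul' := fun c v => by ext i; simp }

/-- The Fourier transform `v̂(ξ) = ∫ e^{-iξ·x} v(x) dx` of `v ∈ L²` (extended from `L¹ ∩ L²` by
continuity). Mathlib's `𝓕` has the kernel `e^{-2πi ξ·x}`, hence the rescaling. -/
def hat (v : L2) (ξ : R3) : C3 :=
  (𝓕 (complexify.compLp v : Lp C3 2 (volume : Measure R3)) : Lp C3 2 (volume : Measure R3))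
    ((2 * Real.pi)⁻¹ • ξ)

open Classical in
/-- The precise representative of a locally integrable function `g`: the limit of the averages
of `g` over the balls `B(ξ, r)`, `r → 0`, where it exists, and `0` elsewhere. It depends only on
the almost-everywhere class of `g`, and it equals `g` at every Lebesgue point, in particular almost
everywhere and at every point of continuity. -/
def preciseRep (g : R3 → C3) (ξ : R3) : C3 :=
  if h : ∃ l, Tendsto (fun r : ℝ => ⨍ y in Metric.ball ξ r, g y) (𝓝[>] 0) (𝓝 l)
  then h.choose else 0

/-- The spectral energy of a pair of fields,
`E(k) = ∫_{|ξ|=k} (|û(ξ)|² + |b̂(ξ)|²) dS(ξ)`, written over the unit sphere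
(whose surface measure is `volume.toSphere`) by means of `ξ = kw`, `dS(ξ) = k² dw`. -/
def spectralEnergy (k : ℝ) (u b : L2) : ℝ≥0∞ :=
  ENNReal.ofReal (k ^ 2) * ∫⁻ w : Metric.sphere (0 : R3) 1,
    (‖preciseRep (hat u) (k • (w : R3))‖ₑ ^ 2 + ‖preciseRep (hat b) (k • (w : R3))‖ₑ ^ 2)
      ∂(volume : Measure R3).toSphere

/-! ### Cutoffs in Fourier space and the constants -/

/-- `χ κ` (written `χ̂_κ` in print) is, for each wave vector `κ ≠ 0`, a smooth cutoff function:
it is `1` on the cube of side `δ κ` about `κ` and is supported in the cube of side `2 δ κ` about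
`κ`, where `0 < δ κ < |κ| / (2√3)`; the support lies in `|κ|/2 ≤ |ξ| ≤ 3|κ|/2`. -/
structure IsCutoffFamily (δ : R3 → ℝ) (χ : R3 → R3 → ℝ) : Prop where
  δ_pos : ∀ κ, κ ≠ 0 → 0 < δ κ
  δ_lt : ∀ κ, κ ≠ 0 → δ κ < ‖κ‖ / (2 * Real.sqrt 3)
  smooth : ∀ κ, κ ≠ 0 → ContDiff ℝ ∞ (χ κ)
  nonneg : ∀ κ, κ ≠ 0 → ∀ ξ, 0 ≤ χ κ ξ
  le_one : ∀ κ, κ ≠ 0 → ∀ ξ, χ κ ξ ≤ 1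
  eq_one : ∀ κ, κ ≠ 0 → ∀ ξ : R3, (∀ i, |ξ i - κ i| ≤ δ κ / 2) → χ κ ξ = 1
  support : ∀ κ, κ ≠ 0 → tsupport (χ κ) ⊆ {ξ : R3 | ∀ i, |ξ i - κ i| ≤ δ κ}

/-- `e_p(κ) = (∫ |χ̂_κ û|^p + |χ̂_κ b̂|^p dξ)^{1/p}`. -/
def ep (χ : R3 → R3 → ℝ) (p : ℝ) (κ : R3) (u b : L2) : ℝ≥0∞ :=
  (∫⁻ ξ, (‖χ κ ξ • hat u ξ‖ₑ ^ p + ‖χ κ ξ • hat b ξ‖ₑ ^ p)) ^ (1 / p)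

/-- `F_∞(T) = sup_{κ ≠ 0} (∫₀ᵀ ‖χ̂_κ f̂₁(t)‖²_{L^∞} + ‖χ̂_κ f̂₂(t)‖²_{L^∞} dt)^{1/2}`. -/
def Finfty (χ : R3 → R3 → ℝ) (f₁ f₂ : ℝ → L2) (T : ℝ) : ℝ≥0∞ :=
  ⨆ κ : {κ : R3 // κ ≠ 0},
    (∫⁻ t in Ioo 0 T, (eLpNorm (fun ξ => χ κ ξ • hat (f₁ t) ξ) ∞ volume ^ 2
      + eLpNorm (fun ξ => χ κ ξ • hat (f₂ t) ξ) ∞ volume ^ 2)) ^ (1 / 2 : ℝ)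

/-- `R₃ = 2R²/m + 2F/√m`, with `m = min(ν, η)`. -/
def radius₃ (m R F : ℝ) : ℝ := 2 * R ^ 2 / m + 2 * F / Real.sqrt m

/-- `R₂ = (R₃ + √(4R₁(0)² + R₃²)) / 2`. -/
def radius₂ (m R F R₁ : ℝ) : ℝ :=
  (1 / 2) * (radius₃ m R F + Real.sqrt (4 * R₁ ^ 2 + radius₃ m R F ^ 2))

end MHD

end

noncomputable section

namespace MHD

open SchwartzMap LineDeriv
open scoped Laplacian SchwartzMap

/-! ### Compactly supported functions are dense in the Schwartz space -/

/-! Fix κ with |κ| = k. It suffices to bound ∫₀ᵀ |û(κ,t)|² + |b̂(κ,t)|² dt by (R₂/(√m k²))²; Tonelli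
over the sphere of area 4πk² then gives the theorem. On the Fourier side û(κ,·) formally solves a
linear equation damped at rate νk² (ηk² for b̂). Its initial value is at most R₁/k, its force is
bounded through F_∞, and its quadratic term is bounded in L²(0,T) by R²/√m, because ‖u‖‖∇u‖ +
‖b‖‖∇b‖ ≤ R (‖∇u‖² + ‖∇b‖²)^{1/2}. The energy estimate is a quadratic inequality m k² M² ≤ C M +
(R₁/k)² for the L²(0,T) norm M, whose larger root is at most R₂/(√m k²).

Several devices make this rigorous. Point values are replaced by averages of v̂(2πy) against kernels
g supported within ρ of y₀ = κ/2π. These averages are pairings with divergence-free fields curl curl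
Θ, whose symbol is |2πy|² times the Leray projection; g is divided by |2πy|² to choose Θ
(`inner_testField`, `gradInner_testField`). Such fields are admissible since compactly supported
functions are dense in the Schwartz space.

Time derivatives of the averages are avoided by duality: the test field carries a solution of the
backward equation φ' = νk²φ - H (`backwardSolution_energy`, `pair_estimate`,
`pair_norm_le_of_duality`).

Since |2πy|² is not constant on the support of g, an error kernel (|2πy|² - k²) g appears. It is
O(ρ) times a kernel of the same class, so the estimate closes for the supremum over the class
(`exists_pairNorm_schwartzAvg_le`), and the error disappears as ρ → 0. Fatou's lemma leads from
smooth kernels to ball averages, and from these to the precise representative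
(`lintegral_preciseRep_le`). -/

theorem exists_hasCompactSupport_tendsto_schwartz {F : Type*} [NormedAddCommGroup F]
    [NormedSpace ℝ F] (f : 𝓢(R3, F)) :
    ∃ u : ℕ → 𝓢(R3, F), (∀ n, HasCompactSupport (u n)) ∧ Tendsto u atTop (𝓝 f) := by
  let χ : ContDiffBump (0 : R3) := ⟨1, 2, one_pos, one_lt_two⟩
  let χS : 𝓢(R3, ℝ) := χ.hasCompactSupport.toSchwartzMap χ.contDiff
  let c : ℕ → ℝ := fun n => ((n : ℝ) + 1)⁻¹
  have hc0 : ∀ n, 0 < c n := fun n => by positivity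
  have hc1 : ∀ n, c n ≤ 1 := fun n => inv_le_one_of_one_le₀ (by linarith [n.cast_nonneg (α := ℝ)])
  let ψ : ℕ → R3 → ℝ := fun n x => χ (c n • x)
  have hψs : ∀ n, ContDiff ℝ ∞ (ψ n) := fun n => χ.contDiff.comp (contDiff_const_smul _)
  have hψc : ∀ n, HasCompactSupport (ψ n) := fun n =>
    χ.hasCompactSupport.comp_homeomorph (Homeomorph.smulOfNeZero (c n) (hc0 n).ne')
  have hψt : ∀ n, (ψ n).HasTemperateGrowth := fun n => (hψc n).hasTemperateGrowth (hψs n)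
  have happ : ∀ n x, smulLeftCLM F (ψ n) f x = ψ n x • f x := fun n x =>
    smulLeftCLM_apply_apply (hψt n) f x
  refine ⟨fun n => smulLeftCLM F (ψ n) f, fun n => ?_, ?_⟩
  · have : (smulLeftCLM F (ψ n) f : R3 → F) = fun x => ψ n x • f x := funext (happ n)
    rw [this]
    exact (hψc n).smul_right
  rw [(schwartz_withSeminorms ℝ R3 F).tendsto_nhds]
  rintro ⟨k, m⟩ ε hε
  have hB : ∀ n i x, ‖iteratedFDeriv ℝ i (ψ n) x‖ ≤ SchwartzMap.seminorm ℝ 0 i χS := by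
    intro n i x
    have h1 : iteratedFDeriv ℝ i (ψ n) x = c n ^ i • iteratedFDeriv ℝ i χ (c n • x) :=
      congrFun (iteratedFDeriv_comp_const_smul (c n) (χ.contDiff (n := i))) x
    rw [h1, norm_smul, norm_pow, Real.norm_of_nonneg (hc0 n).le]
    calc _ ≤ 1 * ‖iteratedFDeriv ℝ i χ (c n • x)‖ := by
          gcongr; exact pow_le_one₀ (hc0 n).le (hc1 n)
      _ ≤ _ := by rw [one_mul]; exact norm_iteratedFDeriv_le_seminorm ℝ χS i _
  let C : ℝ := (∑ i ∈ Finset.range (m + 1), (m.choose i : ℝ) * SchwartzMap.seminorm ℝ 0 i χS *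
    SchwartzMap.seminorm ℝ (k + 1) (m - i) f) + SchwartzMap.seminorm ℝ (k + 1) m f
  have hC : 0 ≤ C := by positivity
  have key : ∀ n, SchwartzMap.seminorm ℝ k m (smulLeftCLM F (ψ n) f - f) ≤ c n * C := by
    intro n
    refine seminorm_le_bound ℝ k m _ (mul_nonneg (hc0 n).le hC) fun x => ?_
    -- Inside the plateau of the cutoff the difference vanishes near x. Outside, 1 ≤ c n * ‖x‖, so
    -- one more power of the weight buys the factor c n.
    by_cases hx : ‖c n • x‖ < 1
    · have h0 : ((smulLeftCLM F (ψ n) f - f : 𝓢(R3, F)) : R3 → F) =ᶠ[𝓝 x] fun _ => 0 := by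
        have : ∀ᶠ y in 𝓝 x, ‖c n • y‖ < 1 :=
          (continuous_norm.comp (continuous_const_smul (c n))).continuousAt.eventually_lt
            continuousAt_const hx
        filter_upwards [this] with y hy
        have : ψ n y = 1 := χ.one_of_mem_closedBall (by simpa [χ] using hy.le)
        rw [sub_apply, happ, this, one_smul, sub_self]
      rw [(h0.iteratedFDeriv ℝ m).self_of_nhds]
      have : iteratedFDeriv ℝ m (fun _ : R3 => (0 : F)) x = 0 := by
        rw [iteratedFDeriv_fun_zero]; rfl
      rw [this, norm_zero, mul_zero]
      exact mul_nonneg (hc0 n).le hC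
    · rw [not_lt, norm_smul, Real.norm_of_nonneg (hc0 n).le] at hx
      have e1 : ((smulLeftCLM F (ψ n) f - f : 𝓢(R3, F)) : R3 → F) = (fun y => ψ n y • f y) - f := by
        ext y; rw [sub_apply, happ]; rfl
      have h2 : iteratedFDeriv ℝ m ((smulLeftCLM F (ψ n) f - f : 𝓢(R3, F)) : R3 → F) x =
          iteratedFDeriv ℝ m (fun y => ψ n y • f y) x - iteratedFDeriv ℝ m f x := by
        rw [e1, iteratedFDeriv_sub_apply]
        · exact (((hψs n).smul (f.smooth ⊤)).of_le (mod_cast le_top)).contDiffAt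
        · exact ((f.smooth ⊤).of_le (mod_cast le_top)).contDiffAt
      have h3 : ‖iteratedFDeriv ℝ m (fun y => ψ n y • f y) x‖ ≤
          ∑ i ∈ Finset.range (m + 1), (m.choose i : ℝ) * SchwartzMap.seminorm ℝ 0 i χS *
            ‖iteratedFDeriv ℝ (m - i) f x‖ := by
        refine (norm_iteratedFDeriv_smul_le (hψs n) (f.smooth ⊤) x (mod_cast le_top)).trans ?_
        gcongr with i hi
        exact hB n i x
      calc ‖x‖ ^ k * _ ≤ (c n * ‖x‖) * (‖x‖ ^ k *
            ((∑ i ∈ Finset.range (m + 1), (m.choose i : ℝ) * SchwartzMap.seminorm ℝ 0 i χS *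
            ‖iteratedFDeriv ℝ (m - i) f x‖) + ‖iteratedFDeriv ℝ m f x‖)) := by
            rw [h2]
            rw [← one_mul (‖x‖ ^ k * _)]
            gcongr
            exact (norm_sub_le _ _).trans (add_le_add h3 le_rfl)
        _ = c n * ((∑ i ∈ Finset.range (m + 1), (m.choose i : ℝ) * SchwartzMap.seminorm ℝ 0 i χS *
            (‖x‖ ^ (k + 1) * ‖iteratedFDeriv ℝ (m - i) f x‖)) +
              ‖x‖ ^ (k + 1) * ‖iteratedFDeriv ℝ m f x‖) := by
            rw [mul_assoc, ← mul_assoc ‖x‖, ← pow_succ', mul_add, Finset.mul_sum]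
            congr 2
            exact Finset.sum_congr rfl fun i _ => by ring
        _ ≤ c n * C := by
            have := (hc0 n).le
            refine mul_le_mul_of_nonneg_left (add_le_add ?_ (le_seminorm ℝ _ _ f x)) this
            gcongr
            exact le_seminorm ℝ _ _ f x
  have hlim : Tendsto (fun n => c n * C) atTop (𝓝 0) := by
    simpa [c] using (tendsto_one_div_add_atTop_nhds_zero_nat (𝕜 := ℝ)).mul_const C
  filter_upwards [hlim.eventually_lt_const hε] with n hn
  exact (key n).trans_lt hn

/-! ### The double curl of a Schwartz field -/

/-- The standard basis of `ℝ³`. -/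
def bvec (j : Fin 3) : R3 := EuclideanSpace.single j 1

/-- The elementary matrix `v ↦ v_j e_i`. -/
def elemCLM (𝕜 : Type*) [RCLike 𝕜] (i j : Fin 3) :
    EuclideanSpace 𝕜 (Fin 3) →L[ℝ] EuclideanSpace 𝕜 (Fin 3) :=
  (((EuclideanSpace.proj j : EuclideanSpace 𝕜 (Fin 3) →L[𝕜] 𝕜).smulRight
    (EuclideanSpace.single i (1 : 𝕜))).restrictScalars ℝ)

theorem elemCLM_apply (𝕜 : Type*) [RCLike 𝕜] (i j : Fin 3) (v : EuclideanSpace 𝕜 (Fin 3)) :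
    elemCLM 𝕜 i j v = EuclideanSpace.single i (v j) := by
  ext l; simp [elemCLM]

/-- `∇ div Θ`. -/
def gradDiv (𝕜 : Type*) [RCLike 𝕜] :
    𝓢(R3, EuclideanSpace 𝕜 (Fin 3)) →L[ℝ] 𝓢(R3, EuclideanSpace 𝕜 (Fin 3)) :=
  ∑ i, ∑ j, (lineDerivOpCLM ℝ _ (bvec i)) ∘L (lineDerivOpCLM ℝ _ (bvec j)) ∘L
    postcompCLM (elemCLM 𝕜 i j)

/-- `curl curl Θ = ∇ div Θ - ΔΘ`. -/
def curlCurl (𝕜 : Type*) [RCLike 𝕜] :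
    𝓢(R3, EuclideanSpace 𝕜 (Fin 3)) →L[ℝ] 𝓢(R3, EuclideanSpace 𝕜 (Fin 3)) :=
  gradDiv 𝕜 - laplacianCLM ℝ R3 _

theorem gradDiv_apply (𝕜 : Type*) [RCLike 𝕜] (Θ : 𝓢(R3, EuclideanSpace 𝕜 (Fin 3))) :
    gradDiv 𝕜 Θ = ∑ i, ∑ j, ∂_{bvec i} (∂_{bvec j} (postcompCLM (elemCLM 𝕜 i j) Θ)) := by
  simp [gradDiv]

theorem laplacian_eq_sum_bvec {F : Type*} [NormedAddCommGroup F] [NormedSpace ℝ F]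
    (Θ : 𝓢(R3, F)) : Δ Θ = ∑ j, ∂_{bvec j} (∂_{bvec j} Θ) := by
  simpa [bvec] using laplacian_eq_sum (EuclideanSpace.basisFun (Fin 3) ℝ) Θ

theorem curlCurl_apply (𝕜 : Type*) [RCLike 𝕜] (Θ : 𝓢(R3, EuclideanSpace 𝕜 (Fin 3))) :
    curlCurl 𝕜 Θ = gradDiv 𝕜 Θ - Δ Θ := by
  simp [curlCurl]

theorem lineDerivOp_comm {F : Type*} [NormedAddCommGroup F] [NormedSpace ℝ F]
    (v w : R3) (f : 𝓢(R3, F)) : ∂_{v} (∂_{w} f) = ∂_{w} (∂_{v} f) := by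
  ext x
  have key : ∀ v w : R3, (∂_{v} (∂_{w} f)) x = fderiv ℝ (fderiv ℝ f) x v w := by
    intro v w
    rw [lineDerivOp_apply_eq_fderiv]
    have : ((∂_{w} f : 𝓢(R3, F)) : R3 → F) = fun y => fderiv ℝ f y w := by
      ext y; exact lineDerivOp_apply_eq_fderiv w f y
    rw [this, fderiv_clm_apply]
    · simp
    · exact (((f.smooth 2).fderiv_right (m := 1) (by norm_num)).differentiable (by norm_num)) x
    · exact differentiableAt_const _
  rw [key, key]
  exact ((f.smooth 2).contDiffAt.isSymmSndFDerivAt (by simp)) v w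

theorem postcompCLM_lineDerivOp {F G : Type*} [NormedAddCommGroup F] [NormedSpace ℝ F]
    [NormedAddCommGroup G] [NormedSpace ℝ G] (L : F →L[ℝ] G) (v : R3) (f : 𝓢(R3, F)) :
    postcompCLM L (∂_{v} f) = ∂_{v} (postcompCLM L f) := by
  ext x
  rw [postcompCLM_apply, lineDerivOp_apply_eq_fderiv, lineDerivOp_apply_eq_fderiv]
  have : ((postcompCLM L f : 𝓢(R3, G)) : R3 → G) = L ∘ f := by ext y; simp
  rw [this, fderiv_comp x L.differentiableAt f.differentiableAt]
  simp

/-- Component l is ∑_j (∂_l∂_jΘ_j - ∂_j∂_jΘ_l). After applying ∂_l and summing, the two double sums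
agree up to exchanging the indices. -/
theorem div_curlCurl (Θ : 𝓢(R3, R3)) (x : R3) : ∑ l, (pderiv l (curlCurl ℝ Θ) x) l = 0 := by
  let pr : Fin 3 → R3 →L[ℝ] ℝ := fun l => EuclideanSpace.proj l
  have h1 : ∀ l, (pderiv l (curlCurl ℝ Θ) x) l =
      (∂_{bvec l} (postcompCLM (pr l) (curlCurl ℝ Θ))) x := by
    intro l
    rw [← postcompCLM_lineDerivOp, postcompCLM_apply, lineDerivOp_apply_eq_fderiv]
    rfl
  have h2 : ∀ l i j, postcompCLM (pr l) (postcompCLM (elemCLM ℝ i j) Θ) =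
      if i = l then postcompCLM (pr j) Θ else 0 := by
    intro l i j
    ext y
    split_ifs with h
    · simp [pr, elemCLM_apply, h]
    · simp [pr, elemCLM_apply, Ne.symm h]
  have h3 : ∀ l, postcompCLM (pr l) (curlCurl ℝ Θ) =
      ∑ j, (∂_{bvec l} (∂_{bvec j} (postcompCLM (pr j) Θ))
        - ∂_{bvec j} (∂_{bvec j} (postcompCLM (pr l) Θ))) := by
    intro l
    rw [curlCurl_apply, gradDiv_apply, laplacian_eq_sum_bvec, map_sub, map_sum, map_sum,
      Finset.sum_sub_distrib]
    congr 1
    · simp_rw [map_sum, postcompCLM_lineDerivOp, h2]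
      rw [Finset.sum_comm]
      refine Finset.sum_congr rfl fun j _ => ?_
      rw [Finset.sum_eq_single l]
      · simp
      · intro i _ hi; simp [hi]
      · simp
    · simp_rw [postcompCLM_lineDerivOp]
  have h4 : ∑ l, ∂_{bvec l} (postcompCLM (pr l) (curlCurl ℝ Θ)) = (0 : 𝓢(R3, ℝ)) := by
    have hsub : ∀ (v : R3) (f g : 𝓢(R3, ℝ)), ∂_{v} (f - g) = ∂_{v} f - ∂_{v} g := fun v =>
      map_sub (lineDerivOpCLM ℝ 𝓢(R3, ℝ) v)
    simp_rw [h3, lineDerivOp_sum, hsub, Finset.sum_sub_distrib]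
    rw [sub_eq_zero, Finset.sum_comm]
    refine Finset.sum_congr rfl fun j _ => Finset.sum_congr rfl fun l _ => ?_
    rw [lineDerivOp_comm (bvec l) (bvec j), lineDerivOp_comm (bvec l) (bvec j)]
  simp_rw [h1]
  rw [← sum_apply, h4]; rfl

theorem hasCompactSupport_curlCurl {Θ : 𝓢(R3, R3)} (h : HasCompactSupport Θ) :
    HasCompactSupport (curlCurl ℝ Θ) := by
  have hd : ∀ (v : R3) (f : 𝓢(R3, R3)), HasCompactSupport f →
      HasCompactSupport (∂_{v} f : 𝓢(R3, R3)) :=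
    fun v f hf => hf.mono' ((subset_tsupport _).trans (tsupport_lineDerivOp_subset v f))
  have hs : ∀ (f : Fin 3 → 𝓢(R3, R3)), (∀ i, HasCompactSupport (f i)) →
      HasCompactSupport (∑ i, f i : 𝓢(R3, R3)) := by
    intro f hf
    have : ((∑ i, f i : 𝓢(R3, R3)) : R3 → R3) = f 0 + f 1 + f 2 := by
      ext x; simp [Fin.sum_univ_three]
    rw [this]
    exact ((hf 0).add (hf 1)).add (hf 2)
  have e : (curlCurl ℝ Θ : R3 → R3) = (gradDiv ℝ Θ : R3 → R3) + -(Δ Θ : 𝓢(R3, R3)) := by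
    rw [curlCurl_apply, ← sub_eq_add_neg]; ext x; rfl
  rw [e]
  refine HasCompactSupport.add ?_ ?_
  · rw [gradDiv_apply]
    refine hs _ fun i => hs _ fun j => hd _ _ (hd _ _ ?_)
    exact h.comp_left (g := elemCLM ℝ i j) (map_zero _)
  · rw [laplacian_eq_sum_bvec]
    exact (hs _ fun j => hd _ _ (hd _ _ h)).neg

theorem curlCurl_mem_testFields {Θ : 𝓢(R3, R3)} (h : HasCompactSupport Θ) :
    (curlCurl ℝ Θ : R3 → R3) ∈ testFields :=
  ⟨(curlCurl ℝ Θ).smooth ⊤, hasCompactSupport_curlCurl h, div_curlCurl Θ⟩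

/-- The `L²` class of a Schwartz field. -/
def schwartzL2 : 𝓢(R3, R3) →L[ℝ] L2 := toLpCLM ℝ R3 2 volume

theorem coeFn_schwartzL2 (f : 𝓢(R3, R3)) : (schwartzL2 f : R3 → R3) =ᵐ[volume] f :=
  f.coeFn_toLp 2 volume

/-- The `L²` class of a Schwartz field with the classes of its partial derivatives. -/
def gradPair : 𝓢(R3, R3) →L[ℝ] L2 × (Fin 3 → L2) :=
  schwartzL2.prod
    (ContinuousLinearMap.pi fun j => schwartzL2 ∘L lineDerivOpCLM ℝ _ (bvec j))

theorem gradPair_apply (f : 𝓢(R3, R3)) :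
    gradPair f = (schwartzL2 f, fun j => schwartzL2 (∂_{bvec j} f)) := rfl

/-- Truncating the potential Θ, rather than the field, preserves the divergence constraint.
Continuity of curl curl and of the gradient on the Schwartz space then removes the truncation. -/
theorem gradPair_curlCurl_mem (Θ : 𝓢(R3, R3)) : gradPair (curlCurl ℝ Θ) ∈ gradGraph := by
  obtain ⟨u, hu, hlim⟩ := exists_hasCompactSupport_tendsto_schwartz Θ
  refine mem_closure_of_tendsto
    (((gradPair ∘L curlCurl ℝ).continuous.tendsto Θ).comp hlim) (Eventually.of_forall fun n => ?_)
  refine ⟨_, curlCurl_mem_testFields (hu n), coeFn_schwartzL2 _, fun j => ?_⟩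
  refine (coeFn_schwartzL2 _).trans (Eventually.of_forall fun x => ?_)
  exact lineDerivOp_apply_eq_fderiv (bvec j) _ x

/-! ### Weak gradients -/

theorem inner_schwartzL2_schwartzL2 (f g : 𝓢(R3, R3)) :
    inner ℝ (schwartzL2 f) (schwartzL2 g) = ∫ x, inner ℝ (f x) (g x) := by
  rw [L2.inner_def]
  apply integral_congr_ae
  filter_upwards [coeFn_schwartzL2 f, coeFn_schwartzL2 g] with x hf hg
  rw [hf, hg]

theorem inner_lineDerivOp_schwartzL2 (f g : 𝓢(R3, R3)) (v : R3) :
    inner ℝ (schwartzL2 (∂_{v} f)) (schwartzL2 g) =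
      - inner ℝ (schwartzL2 f) (schwartzL2 (∂_{v} g)) := by
  rw [inner_schwartzL2_schwartzL2, inner_schwartzL2_schwartzL2]
  have := integral_bilinear_lineDerivOp_right_eq_neg_left (μ := volume) f g (innerSL ℝ) v
  exact (neg_eq_iff_eq_neg.mpr this).symm

theorem exists_schwartz_of_testFields {φ : R3 → R3} (h : φ ∈ testFields) :
    ∃ f : 𝓢(R3, R3), (f : R3 → R3) = φ ∧ ∀ x, ∑ j, (∂_{bvec j} f) x j = 0 := by
  refine ⟨h.2.1.toSchwartzMap h.1, rfl, fun x => ?_⟩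
  refine Eq.trans ?_ (h.2.2 x)
  refine Finset.sum_congr rfl fun j _ => ?_
  rw [lineDerivOp_apply_eq_fderiv]
  rfl

theorem eq_schwartzL2_of_ae_eq {v : L2} {f : 𝓢(R3, R3)} (h : (v : R3 → R3) =ᵐ[volume] f) :
    v = schwartzL2 f :=
  Lp.ext (h.trans (coeFn_schwartzL2 f).symm)

/-- Reduces closed conditions on a field and its weak gradient to classical calculus with Schwartz
fields. -/
theorem gradGraph_induction {P : L2 × (Fin 3 → L2) → Prop} (hP : IsClosed {p | P p})
    (h : ∀ f : 𝓢(R3, R3), (∀ x, ∑ j, (∂_{bvec j} f) x j = 0) → P (gradPair f))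
    {p : L2 × (Fin 3 → L2)} (hp : p ∈ gradGraph) : P p := by
  refine closure_minimal ?_ hP hp
  rintro ⟨v, g⟩ ⟨φ, hφ, hv, hg⟩
  obtain ⟨f, hf, hdiv⟩ := exists_schwartz_of_testFields hφ
  have h1 : (v, g) = gradPair f := by
    rw [gradPair_apply]
    refine Prod.ext (eq_schwartzL2_of_ae_eq (hf ▸ hv)) (funext fun j => eq_schwartzL2_of_ae_eq ?_)
    refine (hg j).trans (Eventually.of_forall fun x => ?_)
    rw [lineDerivOp_apply_eq_fderiv, hf]
    rfl
  rw [mem_ofPred_eq, h1]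
  exact h f hdiv

theorem L2sigma_induction {P : L2 → Prop} (hP : IsClosed {p | P p})
    (h : ∀ f : 𝓢(R3, R3), (∀ x, ∑ j, (∂_{bvec j} f) x j = 0) → P (schwartzL2 f))
    {v : L2} (hv : v ∈ L2sigma) : P v := by
  refine closure_minimal ?_ hP hv
  rintro v ⟨φ, hφ, hv⟩
  obtain ⟨f, hf, hdiv⟩ := exists_schwartz_of_testFields hφ
  have e : v = schwartzL2 f := eq_schwartzL2_of_ae_eq (hf ▸ hv)
  rw [mem_ofPred_eq, e]
  exact h f hdiv

theorem mem_L2sigma_of_mem_gradGraph {p : L2 × (Fin 3 → L2)} (hp : p ∈ gradGraph) :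
    p.1 ∈ L2sigma := by
  have : MapsTo Prod.fst {p : L2 × (Fin 3 → L2) | ∃ φ ∈ testFields, (p.1 : R3 → R3) =ᵐ[volume] φ ∧
    ∀ j, (p.2 j : R3 → R3) =ᵐ[volume] pderiv j φ}
    {v : L2 | ∃ φ ∈ testFields, (v : R3 → R3) =ᵐ[volume] φ} :=
    fun p ⟨φ, hφ, hv, _⟩ => ⟨φ, hφ, hv⟩
  exact this.closure continuous_fst hp

theorem inner_gradGraph {p : L2 × (Fin 3 → L2)} (hp : p ∈ gradGraph) (ζ : 𝓢(R3, R3)) (j : Fin 3) :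
    inner ℝ (p.2 j) (schwartzL2 ζ) = - inner ℝ p.1 (schwartzL2 (∂_{bvec j} ζ)) := by
  refine gradGraph_induction (P := fun p => inner ℝ (p.2 j) (schwartzL2 ζ) =
    - inner ℝ p.1 (schwartzL2 (∂_{bvec j} ζ))) (isClosed_eq ?_ ?_)
    (fun f _ => inner_lineDerivOp_schwartzL2 f ζ _) hp
  · fun_prop
  · fun_prop

/-- Integration by parts fixes the pairings of the gradient with Schwartz fields, which are dense in
L². Hence the choice made in `weakGrad` is immaterial. -/
theorem gradGraph_unique {v : L2} {g g' : Fin 3 → L2} (h : (v, g) ∈ gradGraph)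
    (h' : (v, g') ∈ gradGraph) : g = g' := by
  ext1 j
  refine ext_inner_right ℝ fun w => ?_
  have hd := denseRange_toLpCLM (E := R3) (F := R3) (p := 2) (μ := volume) (by norm_num)
  refine hd.induction_on (p := fun w => inner ℝ (g j) w = inner ℝ (g' j) w) w
    (isClosed_eq (by fun_prop) (by fun_prop)) fun ζ => ?_
  exact (inner_gradGraph h ζ j).trans (inner_gradGraph h' ζ j).symm

theorem weakGrad_mem {v : L2} (h : v ∈ H1sigma) : (v, weakGrad v) ∈ gradGraph := by
  have h' : ∃ g, (v, g) ∈ gradGraph := h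
  rw [weakGrad, dif_pos h']
  exact h'.choose_spec

theorem weakGrad_eq {v : L2} {g : Fin 3 → L2} (h : (v, g) ∈ gradGraph) : weakGrad v = g :=
  gradGraph_unique (weakGrad_mem ⟨g, h⟩) h

theorem curlCurl_mem_H1sigma (Θ : 𝓢(R3, R3)) : schwartzL2 (curlCurl ℝ Θ) ∈ H1sigma :=
  ⟨_, gradPair_curlCurl_mem Θ⟩

theorem weakGrad_curlCurl (Θ : 𝓢(R3, R3)) (j : Fin 3) :
    weakGrad (schwartzL2 (curlCurl ℝ Θ)) j = schwartzL2 (∂_{bvec j} (curlCurl ℝ Θ)) :=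
  congrFun (weakGrad_eq (gradPair_curlCurl_mem Θ)) j

/-- For a divergence-free Schwartz field f, integration by parts turns the pairing into -∫ div f div
Θ = 0; the closure follows by continuity. -/
theorem inner_gradDiv {v : L2} (hv : v ∈ L2sigma) (Θ : 𝓢(R3, R3)) :
    inner ℝ v (schwartzL2 (gradDiv ℝ Θ)) = 0 := by
  refine L2sigma_induction (P := fun v => inner ℝ v (schwartzL2 (gradDiv ℝ Θ)) = 0)
    (isClosed_eq (by fun_prop) continuous_const) (fun f hf => ?_) hv
  have e : (schwartzL2 (gradDiv ℝ Θ)) =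
      ∑ i, ∑ j, schwartzL2 (∂_{bvec i} (∂_{bvec j} (postcompCLM (elemCLM ℝ i j) Θ))) := by
    rw [gradDiv_apply]
    simp_rw [map_sum]
  have h1 : ∀ i j, inner ℝ (schwartzL2 f)
      (schwartzL2 (∂_{bvec i} (∂_{bvec j} (postcompCLM (elemCLM ℝ i j) Θ)))) =
      -∫ x, (∂_{bvec i} f) x i * (∂_{bvec j} Θ) x j := by
    intro i j
    rw [← neg_eq_iff_eq_neg, ← inner_lineDerivOp_schwartzL2, inner_schwartzL2_schwartzL2]
    refine integral_congr_ae (Eventually.of_forall fun x => ?_)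
    simp only
    rw [← postcompCLM_lineDerivOp, postcompCLM_apply, elemCLM_apply]
    rw [EuclideanSpace.inner_single_right]
    exact mul_comm _ _
  have hint : ∀ i j, Integrable (fun x => (∂_{bvec i} f) x i * (∂_{bvec j} Θ) x j) := by
    intro i j
    have hp : ∀ (l : Fin 3) (g : 𝓢(R3, R3)), MemLp (fun x => g x l) 2 := fun l g =>
      (postcompCLM (EuclideanSpace.proj l : R3 →L[ℝ] ℝ) g).memLp 2 volume
    exact (hp i _).integrable_mul (hp j _)
  rw [e]
  simp_rw [inner_sum, h1]
  simp_rw [Finset.sum_neg_distrib]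
  rw [neg_eq_zero]
  have : ∀ i, ∑ j, ∫ x, (∂_{bvec i} f) x i * (∂_{bvec j} Θ) x j =
      ∫ x, ∑ j, (∂_{bvec i} f) x i * (∂_{bvec j} Θ) x j := fun i =>
    (integral_finsetSum _ fun j _ => hint i j).symm
  simp_rw [this]
  rw [← integral_finsetSum _ fun i _ => integrable_finsetSum _ fun j _ => hint i j]
  rw [← integral_zero R3 ℝ]
  congr 1
  ext x
  rw [← Finset.sum_mul_sum, hf x, zero_mul]

theorem inner_curlCurl {v : L2} (hv : v ∈ L2sigma) (Θ : 𝓢(R3, R3)) :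
    inner ℝ v (schwartzL2 (curlCurl ℝ Θ)) = inner ℝ v (schwartzL2 (-Δ Θ)) := by
  have e : (schwartzL2 (curlCurl ℝ Θ)) = schwartzL2 (gradDiv ℝ Θ) + schwartzL2 (-Δ Θ) := by
    rw [curlCurl_apply, sub_eq_add_neg]
    exact map_add (schwartzL2) _ _
  rw [e, inner_add_right, inner_gradDiv hv, zero_add]

theorem lineDerivOp_laplacian {F : Type*} [NormedAddCommGroup F] [NormedSpace ℝ F] (v : R3)
    (f : 𝓢(R3, F)) : ∂_{v} (Δ f) = Δ (∂_{v} f) := by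
  simp_rw [laplacian_eq_sum_bvec, lineDerivOp_sum]
  refine Finset.sum_congr rfl fun j _ => ?_
  rw [lineDerivOp_comm v, lineDerivOp_comm v]

theorem postcompCLM_laplacian {F G : Type*} [NormedAddCommGroup F] [NormedSpace ℝ F]
    [NormedAddCommGroup G] [NormedSpace ℝ G] (L : F →L[ℝ] G) (f : 𝓢(R3, F)) :
    postcompCLM L (Δ f) = Δ (postcompCLM L f) := by
  simp_rw [laplacian_eq_sum_bvec, map_sum, postcompCLM_lineDerivOp]

theorem laplacian_curlCurl (Θ : 𝓢(R3, R3)) : Δ (curlCurl ℝ Θ) = curlCurl ℝ (Δ Θ) := by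
  have hs : ∀ f g : 𝓢(R3, R3), Δ (f - g) = Δ f - Δ g := fun f g =>
    map_sub (laplacianCLM ℝ R3 𝓢(R3, R3)) f g
  have hm : ∀ f : Fin 3 → 𝓢(R3, R3), Δ (∑ i, f i) = ∑ i, Δ (f i) := fun f =>
    map_sum (laplacianCLM ℝ R3 𝓢(R3, R3)) f _
  simp_rw [curlCurl_apply, hs, gradDiv_apply, hm, postcompCLM_laplacian, lineDerivOp_laplacian]

/-- One integration by parts leaves -Δ curl curl Θ = curl curl (-ΔΘ), and v does not see the
gradient part of the double curl. -/
theorem gradInner_curlCurl {v : L2} (hv : v ∈ H1sigma) (Θ : 𝓢(R3, R3)) :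
    gradInner v (schwartzL2 (curlCurl ℝ Θ)) = inner ℝ v (schwartzL2 (-Δ (-Δ Θ))) := by
  have hvg := weakGrad_mem hv
  have hneg : ∀ f : 𝓢(R3, R3), (schwartzL2 (-f)) = -(schwartzL2 f) := fun f =>
    map_neg (schwartzL2) f
  have hl : Δ (-Δ Θ) = -Δ (Δ Θ) := map_neg (laplacianCLM ℝ R3 𝓢(R3, R3)) _
  have e : (schwartzL2 (Δ (curlCurl ℝ Θ))) =
      ∑ j, schwartzL2 (∂_{bvec j} (∂_{bvec j} (curlCurl ℝ Θ))) := by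
    rw [laplacian_eq_sum_bvec]
    exact map_sum (schwartzL2) _ _
  calc gradInner v (schwartzL2 (curlCurl ℝ Θ))
      = ∑ j, - inner ℝ v (schwartzL2 (∂_{bvec j} (∂_{bvec j} (curlCurl ℝ Θ)))) := by
        refine Finset.sum_congr rfl fun j _ => ?_
        rw [weakGrad_curlCurl]
        exact inner_gradGraph hvg _ j
    _ = - inner ℝ v (schwartzL2 (curlCurl ℝ (Δ Θ))) := by
        rw [← laplacian_curlCurl, e, inner_sum, Finset.sum_neg_distrib]
    _ = _ := by
        rw [inner_curlCurl (mem_L2sigma_of_mem_gradGraph hvg), hl, neg_neg, hneg, inner_neg_right,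
          neg_neg]

/-! ### Fourier side -/

/-- The Fourier transform on real square-integrable fields. -/
def fourierField : L2 →L[ℝ] Lp C3 2 (volume : Measure R3) :=
  ((Lp.fourierTransformₗᵢ R3 C3).toContinuousLinearEquiv.toContinuousLinearMap.restrictScalars ℝ) ∘L
    complexify.compLpL 2 volume

theorem fourierField_apply (v : L2) :
    fourierField v = 𝓕 (complexify.compLp v : Lp C3 2 (volume : Measure R3)) := rfl

theorem norm_complexify (v : R3) : ‖complexify v‖ = ‖v‖ := by
  simp [complexify, EuclideanSpace.norm_eq]

theorem norm_fourierField (v : L2) : ‖fourierField v‖ = ‖v‖ := by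
  rw [fourierField_apply, Lp.norm_fourier_eq, Lp.norm_def, Lp.norm_def]
  congr 1
  refine eLpNorm_congr_norm_ae ?_
  filter_upwards [complexify.coeFn_compLp v] with x hx
  rw [hx, norm_complexify]

/-- `v ↦ ∫ g(y) v̂(2πy) dy`. -/
def fourierAvg (g : Lp ℝ 2 (volume : Measure R3)) : L2 →L[ℝ] C3 :=
  (ContinuousLinearMap.lsmul ℝ ℝ : ℝ →L[ℝ] C3 →L[ℝ] C3).lpPairing volume 2 2 g ∘L fourierField

theorem fourierAvg_apply (g : Lp ℝ 2 (volume : Measure R3)) (v : L2) :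
    fourierAvg g v = ∫ y, g y • fourierField v y := by
  simp [fourierAvg, ContinuousLinearMap.lpPairing_eq_integral]

/-- The real part on `ℂ³`. -/
def realPart : C3 →L[ℝ] R3 :=
  LinearMap.toContinuousLinearMap
    { toFun := fun v => WithLp.toLp 2 fun i => (v i).re
      map_add' := fun v w => by ext i; simp
      map_smul' := fun c v => by ext i; simp }

theorem realPart_apply (v : C3) (i : Fin 3) : realPart v i = (v i).re := rfl

theorem complexify_apply (v : R3) (i : Fin 3) : complexify v i = (v i : ℂ) := rfl

theorem norm_realPart_le (v : C3) : ‖realPart v‖ ≤ ‖v‖ := by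
  rw [EuclideanSpace.norm_eq, EuclideanSpace.norm_eq]
  gcongr with i
  rw [realPart_apply, Real.norm_eq_abs]
  exact Complex.abs_re_le_norm _

theorem inner_realPart (v : R3) (w : C3) :
    inner ℝ v (realPart w) = (inner ℂ (complexify v) w).re := by
  simp only [PiLp.inner_apply, Complex.re_sum]
  refine Finset.sum_congr rfl fun i _ => ?_
  simp [realPart_apply, complexify_apply, mul_comm]

theorem fourierInv_postcompCLM {F G : Type*} [NormedAddCommGroup F] [NormedSpace ℂ F]
    [CompleteSpace F] [NormedAddCommGroup G] [NormedSpace ℂ G] [CompleteSpace G]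
    (L : F →L[ℂ] G) (f : 𝓢(R3, F)) :
    𝓕⁻ (postcompCLM (L.restrictScalars ℝ) f) = postcompCLM (L.restrictScalars ℝ) (𝓕⁻ f) := by
  ext x
  rw [postcompCLM_apply, fourierInv_coe, fourierInv_coe, Real.fourierInv_eq_fourier_neg,
    Real.fourierInv_eq_fourier_neg, Real.fourier_eq, Real.fourier_eq]
  simp only [ContinuousLinearMap.coe_restrictScalars', postcompCLM_apply]
  rw [← L.integral_comp_comm]
  · congr 1; ext y; simp [Circle.smul_def]
  · exact (Real.fourierIntegral_convergent_iff (-x)).2 f.integrable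

theorem norm_fourierInv_apply_le {F : Type*} [NormedAddCommGroup F] [NormedSpace ℂ F]
    [CompleteSpace F] (f : 𝓢(R3, F)) (x : R3) : ‖(𝓕⁻ f) x‖ ≤ ∫ y, ‖f y‖ := by
  rw [fourierInv_coe, Real.fourierInv_eq_fourier_neg, Real.fourier_eq]
  refine (norm_integral_le_integral_norm _).trans_eq ?_
  simp

/-- Multiplication by `|2πy|²`. -/
def mulSq : 𝓢(R3, ℝ) →L[ℝ] 𝓢(R3, ℝ) := smulLeftCLM ℝ fun y => (2 * Real.pi) ^ 2 * ‖y‖ ^ 2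

theorem mulSq_apply (h : 𝓢(R3, ℝ)) (y : R3) : mulSq h y = (2 * Real.pi) ^ 2 * ‖y‖ ^ 2 * h y := by
  rw [mulSq, smulLeftCLM_apply_apply (by fun_prop), smul_eq_mul]

/-- The field `𝓕⁻¹ (h c)`. -/
def potential (h : 𝓢(R3, ℝ)) : C3 →ₗ[ℝ] 𝓢(R3, C3) where
  toFun c := 𝓕⁻ (postcompCLM (ContinuousLinearMap.toSpanSingleton ℝ c) h)
  map_add' c c' := by
    rw [← FourierTransform.fourierInv_add]
    congr 1
    ext x : 1
    simp
  map_smul' r c := by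
    have := FourierTransform.fourierInv_smul (R := ℝ)  r
      (postcompCLM (ContinuousLinearMap.toSpanSingleton ℝ c) h)
    rw [RingHom.id_apply, ← this]
    congr 1
    ext x : 1
    simp [smul_comm r]

theorem potential_apply (h : 𝓢(R3, ℝ)) (c : C3) :
    potential h c = 𝓕⁻ (postcompCLM (ContinuousLinearMap.toSpanSingleton ℝ c) h) := rfl

theorem neg_laplacian_potential (h : 𝓢(R3, ℝ)) (c : C3) :
    -Δ (potential h c) = potential (mulSq h) c := by
  rw [potential_apply, laplacian_eq_fourierMultiplierCLM, fourierMultiplierCLM_apply,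
    FourierTransform.fourier_fourierInv_eq, neg_smul, neg_neg, ← FourierTransform.fourierInv_smul]
  rw [potential_apply]
  congr 1
  ext x : 1
  have : ((‖·‖ ^ 2 : R3 → ℝ)).HasTemperateGrowth := by fun_prop
  simp [smulLeftCLM_apply_apply this, mulSq_apply, smul_smul, mul_assoc]

theorem real_inner_eq_re_inner_C3 (v w : C3) : inner ℝ v w = (inner ℂ v w).re := by
  simp [PiLp.inner_apply, Complex.inner]

/-- Plancherel's identity. Because v is real, pairing it with a real part gives the real part of the
Hermitian pairing. -/
theorem inner_realPart_potential (g : 𝓢(R3, ℝ)) (v : L2) (c : C3) :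
    inner ℝ v (schwartzL2 (postcompCLM realPart (potential g c))) =
      inner ℝ (fourierAvg (g.toLp 2) v) c := by
  set z := potential g c
  have hz : 𝓕 z = postcompCLM (ContinuousLinearMap.toSpanSingleton ℝ c) g :=
    FourierTransform.fourier_fourierInv_eq _
  have h1 : inner ℝ v (schwartzL2 (postcompCLM realPart z)) =
      (inner ℂ (complexify.compLp v : Lp C3 2 (volume : Measure R3)) (z.toLp 2)).re := by
    rw [L2.inner_def, L2.inner_def]
    have hi := L2.integrable_inner (𝕜 := ℂ)
      (complexify.compLp v : Lp C3 2 (volume : Measure R3)) (z.toLp 2)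
    refine Eq.trans ?_ (integral_re hi)
    refine integral_congr_ae ?_
    filter_upwards [coeFn_schwartzL2 (postcompCLM realPart z), z.coeFn_toLp 2 volume,
      complexify.coeFn_compLp v] with x h1 h2 h3
    rw [h1, h2, h3, postcompCLM_apply, inner_realPart]
    rfl
  have hi : Integrable fun y => g y • fourierField v y := by
    exact memLp_one_iff_integrable.1 ((Lp.memLp (fourierField v)).smul (g.memLp 2 volume) (r := 1))
  rw [h1, ← Lp.inner_fourier_eq, toLp_fourier_eq, hz, ← fourierField_apply, L2.inner_def]
  have h2 : fourierAvg (g.toLp 2) v = ∫ y, g y • fourierField v y := by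
    rw [fourierAvg_apply]
    refine integral_congr_ae ?_
    filter_upwards [g.coeFn_toLp 2 volume] with y hy
    rw [hy]
  rw [h2, real_inner_comm, ← integral_inner hi]
  have hi2 := L2.integrable_inner (𝕜 := ℂ) (fourierField v)
    ((postcompCLM (ContinuousLinearMap.toSpanSingleton ℝ c) g).toLp 2)
  refine (integral_re hi2).symm.trans ?_
  refine integral_congr_ae ?_
  filter_upwards [(postcompCLM (ContinuousLinearMap.toSpanSingleton ℝ c) g).coeFn_toLp 2 volume]
    with y hy
  rw [hy, postcompCLM_apply, ContinuousLinearMap.toSpanSingleton_apply, real_inner_smul_right,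
    real_inner_comm]
  rw [real_inner_eq_re_inner_C3]
  simp [inner_smul_right_eq_smul]

/-- The vector is |y|² times the projection of c onto the orthogonal complement of y, so Pythagoras
gives the constant 1. It is the symbol of curl curl up to (2π)². -/
theorem norm_sq_smul_sub_le (y : R3) (c : C3) :
    ‖(‖y‖ ^ 2 : ℝ) • c - ∑ i, ∑ j, (y i * y j) • elemCLM ℂ i j c‖ ≤ ‖y‖ ^ 2 * ‖c‖ := by
  set Y := complexify y
  have hY : ‖Y‖ = ‖y‖ := norm_complexify y
  have e : ∑ i, ∑ j, (y i * y j) • elemCLM ℂ i j c = (inner ℂ Y c) • Y := by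
    ext l
    simp only [elemCLM_apply, PiLp.inner_apply]
    simp [Fin.sum_univ_three, Y, complexify_apply]
    fin_cases l <;> simp <;> ring
  rw [e]
  set p := (‖y‖ ^ 2 : ℝ) • c - (inner ℂ Y c) • Y
  have hp : inner ℂ Y p = 0 := by
    simp only [p, inner_sub_right, inner_smul_right, inner_self_eq_norm_sq_to_K, hY]
    rw [inner_smul_right_eq_smul]
    simp [mul_comm]
  have h1 : inner ℂ ((inner ℂ Y c) • Y) p = 0 := by rw [inner_smul_left, hp, mul_zero]
  have h2 : (inner ℂ Y c) • Y + p = (‖y‖ ^ 2 : ℝ) • c := by simp [p]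
  have h3 := norm_add_sq_eq_norm_sq_add_norm_sq_of_inner_eq_zero _ _ h1
  rw [h2, norm_smul, Real.norm_of_nonneg (by positivity)] at h3
  nlinarith [norm_nonneg p, norm_nonneg c, sq_nonneg ‖y‖, mul_nonneg (sq_nonneg ‖y‖) (norm_nonneg c), mul_self_nonneg ‖inner ℂ Y c • Y‖]

theorem curlCurl_realPart (z : 𝓢(R3, C3)) :
    curlCurl ℝ (postcompCLM realPart z) = postcompCLM realPart (curlCurl ℂ z) := by
  have h : ∀ i j, postcompCLM (elemCLM ℝ i j) (postcompCLM realPart z) =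
      postcompCLM realPart (postcompCLM (elemCLM ℂ i j) z) := by
    intro i j
    ext x l
    simp only [postcompCLM_apply, elemCLM_apply, realPart_apply]
    by_cases hl : l = i <;> simp [hl]
  simp_rw [curlCurl_apply, gradDiv_apply, map_sub, map_sum, postcompCLM_laplacian,
    postcompCLM_lineDerivOp, h]

/-- The sup norm is at most the L¹ norm of the Fourier transform, and the Leray projection does not
increase norms. This bound is what lets the quadratic terms be tested: they are only integrable
against bounded fields. -/
theorem norm_curlCurl_potential_le (h : 𝓢(R3, ℝ)) (c : C3) (x : R3) :
    ‖curlCurl ℝ (postcompCLM realPart (potential h c)) x‖ ≤ (∫ y, |mulSq h y|) * ‖c‖ := by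
  set f := postcompCLM (ContinuousLinearMap.toSpanSingleton ℝ c) h
  have ht : ∀ i, (inner ℝ · (bvec i) : R3 → ℝ).HasTemperateGrowth := fun i => by fun_prop
  -- G is the Fourier transform of the double curl. Its first summand comes from -Δ and the double
  -- sum from ∇ div, where ∂_i contributes 2πi y_i.
  obtain ⟨G, hG, hGy⟩ : ∃ G : 𝓢(R3, C3), curlCurl ℂ (potential h c) = 𝓕⁻ G ∧
      ∀ y, G y = ((2 * Real.pi) ^ 2 * h y) •
        ((‖y‖ ^ 2 : ℝ) • c - ∑ i, ∑ j, (y i * y j) • elemCLM ℂ i j c) := by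
    refine ⟨postcompCLM (ContinuousLinearMap.toSpanSingleton ℝ c) (mulSq h) +
      ∑ i, ∑ j, (2 * Real.pi * Complex.I) • smulLeftCLM C3 (inner ℝ · (bvec i))
        ((2 * Real.pi * Complex.I) • smulLeftCLM C3 (inner ℝ · (bvec j))
          (postcompCLM (elemCLM ℂ i j) f)), ?_, fun y => ?_⟩
    · rw [curlCurl_apply, sub_eq_add_neg, neg_laplacian_potential, FourierTransform.fourierInv_add,
        add_comm, ← potential_apply, gradDiv_apply]
      congr 1
      change _ = FourierTransform.fourierInvCLM ℂ 𝓢(R3, C3) _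
      simp_rw [map_sum]
      refine Finset.sum_congr rfl fun i _ => Finset.sum_congr rfl fun j _ => ?_
      rw [potential_apply]
      have := fourierInv_postcompCLM ((EuclideanSpace.proj j : C3 →L[ℂ] ℂ).smulRight
        (EuclideanSpace.single i (1 : ℂ))) f
      rw [elemCLM, ← this, lineDerivOp_fourierInv_eq, lineDerivOp_fourierInv_eq]
      rfl
    · have hb : ∀ i, inner ℝ y (bvec i) = y i := fun i => by
        rw [bvec, EuclideanSpace.inner_single_right]; simp
      have hI : (2 * (Real.pi : ℂ) * Complex.I) * (2 * (Real.pi : ℂ) * Complex.I) =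
          ((-(2 * Real.pi) ^ 2 : ℝ) : ℂ) := by
        push_cast
        linear_combination (4 * (Real.pi : ℂ) ^ 2) * Complex.I_mul_I
      have ht2 : ∀ i j, ((2 * Real.pi * Complex.I) • smulLeftCLM C3 (inner ℝ · (bvec i))
          ((2 * Real.pi * Complex.I) • smulLeftCLM C3 (inner ℝ · (bvec j))
          (postcompCLM (elemCLM ℂ i j) f))) y =
          (-((2 * Real.pi) ^ 2 * h y)) • (y i * y j) • elemCLM ℂ i j c := by
        intro i j
        rw [smul_apply, smulLeftCLM_apply_apply (ht i), smul_apply, smulLeftCLM_apply_apply (ht j),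
          postcompCLM_apply, postcompCLM_apply, ContinuousLinearMap.toSpanSingleton_apply, hb, hb,
          map_smul, smul_comm (y i) (2 * (Real.pi : ℂ) * Complex.I), smul_smul, hI,
          Complex.coe_smul]
        simp only [smul_smul]
        congr 1
        ring
      rw [add_apply, postcompCLM_apply, mulSq_apply, sum_apply]
      simp_rw [sum_apply, ht2, ContinuousLinearMap.toSpanSingleton_apply, ← Finset.smul_sum]
      rw [smul_sub, neg_smul, smul_smul, ← sub_eq_add_neg]
      congr 2
      ring
  rw [curlCurl_realPart, postcompCLM_apply, hG]
  refine (norm_realPart_le _).trans ((norm_fourierInv_apply_le G x).trans ?_)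
  rw [← integral_mul_const]
  refine integral_mono G.integrable.norm ((mulSq h).integrable.norm.mul_const _) fun y => ?_
  simp only [hGy, mulSq_apply, norm_smul, abs_mul]
  rw [Real.norm_eq_abs, abs_mul]
  calc _ ≤ |(2 * Real.pi) ^ 2| * |h y| * (‖y‖ ^ 2 * ‖c‖) := by
        gcongr; exact norm_sq_smul_sub_le y c
    _ = _ := by rw [abs_of_nonneg (sq_nonneg ‖y‖)]; ring

/-! ### Divergence-free test fields with prescribed Fourier transform -/

/-- The real divergence-free field `Re 𝓕⁻¹ (|2πy|² h P_y c)`, with `P_y` the Leray projection. -/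
def testSchwartz (h : 𝓢(R3, ℝ)) : C3 →ₗ[ℝ] 𝓢(R3, R3) :=
  (curlCurl ℝ ∘L postcompCLM realPart).toLinearMap ∘ₗ potential h

theorem testSchwartz_apply (h : 𝓢(R3, ℝ)) (c : C3) :
    testSchwartz h c = curlCurl ℝ (postcompCLM realPart (potential h c)) := rfl

/-- The `L²` class of `testSchwartz`. -/
def testField (h : 𝓢(R3, ℝ)) : C3 →L[ℝ] L2 :=
  LinearMap.toContinuousLinearMap (schwartzL2.toLinearMap ∘ₗ testSchwartz h)

/-- The partial derivatives of `testField`. -/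
def testGrad (h : 𝓢(R3, ℝ)) (j : Fin 3) : C3 →L[ℝ] L2 :=
  LinearMap.toContinuousLinearMap
    ((schwartzL2 ∘L lineDerivOpCLM ℝ 𝓢(R3, R3) (bvec j)).toLinearMap ∘ₗ testSchwartz h)

/-- The class of `testSchwartz` in `L^∞`. -/
def testBounded (h : 𝓢(R3, ℝ)) : C3 →L[ℝ] Lp R3 ∞ (volume : Measure R3) :=
  LinearMap.toContinuousLinearMap ((toLpCLM ℝ R3 ∞ volume).toLinearMap ∘ₗ testSchwartz h)

theorem testField_apply (h : 𝓢(R3, ℝ)) (c : C3) : testField h c = schwartzL2 (testSchwartz h c) :=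
  rfl

theorem testField_mem (h : 𝓢(R3, ℝ)) (c : C3) : testField h c ∈ H1sigma :=
  curlCurl_mem_H1sigma _

theorem weakGrad_testField (h : 𝓢(R3, ℝ)) (c : C3) (j : Fin 3) :
    weakGrad (testField h c) j = testGrad h j c :=
  weakGrad_curlCurl _ j

theorem neg_laplacian_realPart_potential (h : 𝓢(R3, ℝ)) (c : C3) :
    -Δ (postcompCLM realPart (potential h c)) =
      postcompCLM realPart (potential (mulSq h) c) := by
  rw [← postcompCLM_laplacian, ← map_neg, neg_laplacian_potential]

/-- On L²_σ the double curl may be replaced by -Δ, so the Leray projection drops out and the weight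
|2πy|² h remains. -/
theorem inner_testField {v : L2} (hv : v ∈ L2sigma) (h : 𝓢(R3, ℝ)) (c : C3) :
    inner ℝ v (testField h c) = inner ℝ (fourierAvg ((mulSq h).toLp 2) v) c := by
  rw [testField_apply, testSchwartz_apply, inner_curlCurl hv, neg_laplacian_realPart_potential,
    inner_realPart_potential]

theorem gradInner_testField {v : L2} (hv : v ∈ H1sigma) (h : 𝓢(R3, ℝ)) (c : C3) :
    gradInner v (testField h c) = inner ℝ (fourierAvg ((mulSq (mulSq h)).toLp 2) v) c := by
  rw [testField_apply, testSchwartz_apply, gradInner_curlCurl hv,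
    neg_laplacian_realPart_potential, neg_laplacian_realPart_potential, inner_realPart_potential]

/-- The pairing `∫ v_j f dx`. -/
def componentPairing (j : Fin 3) : L2 →L[ℝ] Lp ℝ 2 (volume : Measure R3) →L[ℝ] ℝ :=
  ((ContinuousLinearMap.lsmul ℝ ℝ : ℝ →L[ℝ] ℝ →L[ℝ] ℝ) ∘L
      (EuclideanSpace.proj j : R3 →L[ℝ] ℝ)).lpPairing volume 2 2

/-- The pointwise inner product of a square-integrable field with a bounded one. -/
def innerBounded : L2 →L[ℝ] Lp R3 ∞ (volume : Measure R3) →L[ℝ] Lp ℝ 2 (volume : Measure R3) :=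
  (innerSL ℝ : R3 →L[ℝ] R3 →L[ℝ] ℝ).holderL volume 2 ∞ 2

/-- The convection form as a continuous trilinear form. -/
def convectionForm (v : L2) (g : Fin 3 → L2) (f : Lp R3 ∞ (volume : Measure R3)) : ℝ :=
  ∑ j, componentPairing j v (innerBounded (g j) f)

/-- The right-hand side is continuous on L² × (L²)³ × L^∞, which yields measurability in time. The
L² class of the test field alone would not give this, as a product of three L² functions need not be
integrable. -/
theorem convection_testField (v w : L2) (h : 𝓢(R3, ℝ)) (c : C3) :
    convection v w (testField h c) = convectionForm v (weakGrad w) (testBounded h c) := by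
  simp only [convection, convectionForm, componentPairing,
    innerBounded, ContinuousLinearMap.lpPairing_eq_integral]
  have hB : ∀ (g : Lp ℝ 2 (volume : Measure R3)) (j : Fin 3),
      Integrable fun x => ((ContinuousLinearMap.lsmul ℝ ℝ : ℝ →L[ℝ] ℝ →L[ℝ] ℝ) ∘L
      (EuclideanSpace.proj j : R3 →L[ℝ] ℝ)) (v x) (g x) := fun g j =>
    memLp_one_iff_integrable.1 (ContinuousLinearMap.memLp_of_bilin _ _ (Lp.memLp v) (Lp.memLp g))
  rw [← integral_finsetSum _ fun j _ => hB _ j]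
  refine integral_congr_ae ?_
  have h1 : ∀ᵐ x, ∀ j, ((innerSL ℝ : R3 →L[ℝ] R3 →L[ℝ] ℝ).holderL volume 2 ∞ 2 (weakGrad w j)
      (testBounded h c) : Lp ℝ 2 (volume : Measure R3)) x =
        inner ℝ (weakGrad w j x) (testBounded h c x) := by
    rw [ae_all_iff]
    intro j
    exact (innerSL ℝ : R3 →L[ℝ] R3 →L[ℝ] ℝ).coeFn_holder _ _
  filter_upwards [h1, coeFn_schwartzL2 (testSchwartz h c), (testSchwartz h c).coeFn_toLp ∞ volume]
    with x h1 h2 h3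
  refine Finset.sum_congr rfl fun j _ => ?_
  rw [h1 j, testField_apply, h2]
  change _ = v x j • inner ℝ _ ((testSchwartz h c).toLp ∞ volume x)
  rw [h3, smul_eq_mul]

theorem aestronglyMeasurable_convection {v w : ℝ → L2} {φ : ℝ → C3} {μ : Measure ℝ}
    (h : 𝓢(R3, ℝ)) (hv : AEStronglyMeasurable v μ)
    (hw : ∀ j, AEStronglyMeasurable (fun t => weakGrad (w t) j) μ)
    (hφ : AEStronglyMeasurable φ μ) :
    AEStronglyMeasurable (fun t => convection (v t) (w t) (testField h (φ t))) μ := by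
  simp_rw [convection_testField]
  unfold convectionForm
  refine Finset.aestronglyMeasurable_fun_sum _ fun j _ => ?_
  have hA : AEStronglyMeasurable (fun t => innerBounded (weakGrad (w t) j)
      (testBounded h (φ t))) μ :=
    innerBounded.aestronglyMeasurable_comp₂ (hw j)
      ((testBounded h).continuous.comp_aestronglyMeasurable hφ)
  exact (componentPairing j).aestronglyMeasurable_comp₂ hv hA

theorem integral_norm_sq_eq (v : L2) : ∫ x, ‖v x‖ ^ 2 = ‖v‖ ^ 2 := by
  rw [← real_inner_self_eq_norm_sq v, L2.inner_def]
  simp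

theorem norm_testSchwartz_le (h : 𝓢(R3, ℝ)) (c : C3) (x : R3) :
    ‖testSchwartz h c x‖ ≤ (∫ y, |mulSq h y|) * ‖c‖ :=
  norm_curlCurl_potential_le h c x

theorem gradNormSq_nonneg (v : L2) : 0 ≤ gradNormSq v :=
  Finset.sum_nonneg fun _ _ => by positivity

/-- Cauchy–Schwarz in the index j at each point, then in x, with the test field bounded by
`norm_testSchwartz_le`. No constant is lost. -/
theorem abs_convection_testField_le (v w : L2) (h : 𝓢(R3, ℝ)) (c : C3) :
    |convection v w (testField h c)| ≤
      ‖v‖ * √(gradNormSq w) * ((∫ y, |mulSq h y|) * ‖c‖) := by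
  set K := (∫ y, |mulSq h y|) * ‖c‖
  have hK : 0 ≤ K := by positivity
  let G : R3 → ℝ := fun x => √(∑ j, ‖weakGrad w j x‖ ^ 2)
  have hG2 : ∀ x, G x ^ 2 = ∑ j, ‖weakGrad w j x‖ ^ 2 := fun x =>
    Real.sq_sqrt (Finset.sum_nonneg fun _ _ => by positivity)
  have hsq : ∀ v : L2, Integrable fun x => ‖v x‖ ^ 2 := fun v =>
    (Lp.memLp v).integrable_norm_pow two_ne_zero
  have hGm : MemLp G 2 := by
    refine (memLp_two_iff_integrable_sq ?_).2 ?_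
    · exact Real.continuous_sqrt.comp_aestronglyMeasurable (Finset.aestronglyMeasurable_fun_sum _
        fun j _ => ((Lp.aestronglyMeasurable _).norm.pow 2))
    · simp_rw [hG2]
      exact integrable_finsetSum _ fun j _ => hsq _
  have hGi : ∫ x, G x ^ 2 = gradNormSq w := by
    simp_rw [hG2]
    rw [integral_finsetSum _ fun j _ => hsq _]
    simp_rw [integral_norm_sq_eq]
    rfl
  have hb : ∀ᵐ x, ‖∑ j, (v x) j * inner ℝ (weakGrad w j x) (testField h c x)‖ ≤
      K * (‖v x‖ * G x) := by
    filter_upwards [coeFn_schwartzL2 (testSchwartz h c)] with x hx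
    rw [testField_apply, hx]
    calc ‖∑ j, (v x) j * inner ℝ (weakGrad w j x) (testSchwartz h c x)‖
        ≤ ∑ j, ‖(v x) j‖ * (‖weakGrad w j x‖ * K) := by
          refine (norm_sum_le _ _).trans (Finset.sum_le_sum fun j _ => ?_)
          rw [norm_mul]
          gcongr
          refine (norm_inner_le_norm _ _).trans ?_
          gcongr
          exact norm_testSchwartz_le h c x
      _ = K * ∑ j, ‖(v x) j‖ * ‖weakGrad w j x‖ := by
          rw [Finset.mul_sum]; exact Finset.sum_congr rfl fun j _ => by ring
      _ ≤ K * (‖v x‖ * G x) := by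
          gcongr
          rw [EuclideanSpace.norm_eq]
          exact Real.sum_mul_le_sqrt_mul_sqrt _ _ _
  have hint : Integrable fun x => ‖v x‖ * G x := (Lp.memLp v).norm.integrable_mul hGm
  refine (norm_integral_le_of_norm_le (hint.const_mul K) hb).trans ?_
  rw [integral_const_mul, mul_comm]
  gcongr
  have := integral_mul_le_Lp_mul_Lq_of_nonneg (μ := (volume : Measure R3))
    Real.HolderConjugate.two_two (f := fun x => ‖v x‖) (g := G)
    (Eventually.of_forall fun x => norm_nonneg _) (Eventually.of_forall fun x => Real.sqrt_nonneg _)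
    (by simpa using (Lp.memLp v).norm) (by simpa using hGm)
  refine this.trans_eq ?_
  simp only [Real.rpow_two, hGi, integral_norm_sq_eq, ← Real.sqrt_eq_rpow]
  rw [Real.sqrt_sq (norm_nonneg _)]

/-! ### Testing the weak formulation -/

/-- The `L²(0,T)` norm of a function of time. -/
def timeNorm {F : Type*} [NormedAddCommGroup F] (T : ℝ) (f : ℝ → F) : ℝ :=
  √(∫ t in Ioo 0 T, ‖f t‖ ^ 2)

theorem timeNorm_nonneg {F : Type*} [NormedAddCommGroup F] (T : ℝ) (f : ℝ → F) :
    0 ≤ timeNorm T f := Real.sqrt_nonneg _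

theorem timeNorm_sq {F : Type*} [NormedAddCommGroup F] (T : ℝ) (f : ℝ → F) :
    timeNorm T f ^ 2 = ∫ t in Ioo 0 T, ‖f t‖ ^ 2 :=
  Real.sq_sqrt (integral_nonneg fun _ => by positivity)

theorem integral_norm_mul_norm_le {F G : Type*} [NormedAddCommGroup F] [NormedAddCommGroup G]
    {T : ℝ} {f : ℝ → F} {g : ℝ → G}
    (hf : MemLp f 2 (volume.restrict (Ioo 0 T))) (hg : MemLp g 2 (volume.restrict (Ioo 0 T))) :
    ∫ t in Ioo 0 T, ‖f t‖ * ‖g t‖ ≤ timeNorm T f * timeNorm T g := by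
  have := integral_mul_le_Lp_mul_Lq_of_nonneg (μ := volume.restrict (Ioo 0 T))
    Real.HolderConjugate.two_two (f := fun x => ‖f x‖) (g := fun x => ‖g x‖)
    (Eventually.of_forall fun x => norm_nonneg _) (Eventually.of_forall fun x => norm_nonneg _)
    (by simpa using hf.norm) (by simpa using hg.norm)
  simpa only [Real.rpow_two, ← Real.sqrt_eq_rpow, timeNorm] using this

theorem abs_integral_inner_le {F : Type*} [NormedAddCommGroup F] [InnerProductSpace ℝ F]
    {T : ℝ} {f g : ℝ → F}
    (hf : MemLp f 2 (volume.restrict (Ioo 0 T))) (hg : MemLp g 2 (volume.restrict (Ioo 0 T))) :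
    |∫ t in Ioo 0 T, inner ℝ (f t) (g t)| ≤ timeNorm T f * timeNorm T g := by
  refine le_trans ?_ (integral_norm_mul_norm_le hf hg)
  exact norm_integral_le_of_norm_le (hf.norm.integrable_mul hg.norm)
    (Eventually.of_forall fun t => norm_inner_le_norm (𝕜 := ℝ) (f t) (g t))

theorem integrable_inner_of_memLp {F : Type*} [NormedAddCommGroup F] [InnerProductSpace ℝ F]
    {μ : Measure ℝ} {f g : ℝ → F} (hf : MemLp f 2 μ) (hg : MemLp g 2 μ) :
    Integrable (fun t => inner ℝ (f t) (g t)) μ :=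
  memLp_one_iff_integrable.1 ((innerSL ℝ : F →L[ℝ] F →L[ℝ] ℝ).memLp_of_bilin 1 hf hg)

theorem memLp_Ioo_of_continuous {F : Type*} [NormedAddCommGroup F] {f : ℝ → F} (hf : Continuous f)
    (T : ℝ) (p : ℝ≥0∞) : MemLp f p (volume.restrict (Ioo 0 T)) := by
  obtain ⟨C, hC⟩ := isCompact_Icc.exists_bound_of_continuousOn (s := Icc 0 T) hf.continuousOn
  refine MemLp.of_bound hf.aestronglyMeasurable C ?_
  filter_upwards [ae_restrict_mem measurableSet_Ioo] with t ht
  exact hC t (Ioo_subset_Icc_self ht)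

theorem intervalIntegral_eq_Ioo {F : Type*} [NormedAddCommGroup F] [NormedSpace ℝ F] {T : ℝ}
    (hT : 0 < T) (f : ℝ → F) : ∫ t in (0 : ℝ)..T, f t = ∫ t in Ioo 0 T, f t := by
  rw [intervalIntegral.integral_of_le hT.le, integral_Ioc_eq_integral_Ioo]

/-- The solution of `φ' = lφ - H`, `φ(T) = 0`. -/
def backwardSolution (l T : ℝ) (H : ℝ → C3) (t : ℝ) : C3 :=
  Real.exp (l * t) • ∫ s in t..T, Real.exp (-(l * s)) • H s

theorem hasDerivAt_backwardSolution (l T : ℝ) {H : ℝ → C3} (hH : Continuous H) (t : ℝ) :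
    HasDerivAt (backwardSolution l T H) (l • backwardSolution l T H t - H t) t := by
  have hc : Continuous fun s => Real.exp (-(l * s)) • H s := by fun_prop
  have h1 : HasDerivAt (fun t => Real.exp (l * t)) (Real.exp (l * t) * l) t := by
    simpa using ((hasDerivAt_id t).const_mul l).exp
  have h2 : HasDerivAt (fun t => ∫ s in t..T, Real.exp (-(l * s)) • H s)
      (-(Real.exp (-(l * t)) • H t)) t :=
    intervalIntegral.integral_hasDerivAt_left (hc.intervalIntegrable _ _)
      (hc.stronglyMeasurableAtFilter _ _) hc.continuousAt
  refine (h1.smul h2).congr_deriv ?_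
  rw [smul_neg, smul_smul, ← Real.exp_add, add_neg_cancel, Real.exp_zero, one_smul,
    backwardSolution, smul_smul, mul_comm l (Real.exp _), neg_add_eq_sub]

theorem backwardSolution_end (l T : ℝ) (H : ℝ → C3) : backwardSolution l T H T = 0 := by
  simp [backwardSolution]

theorem continuous_backwardSolution (l T : ℝ) {H : ℝ → C3} (hH : Continuous H) :
    Continuous (backwardSolution l T H) :=
  continuous_iff_continuousAt.2 fun t => (hasDerivAt_backwardSolution l T hH t).continuousAt

/-- Integrate the derivative 2l|φ|² - 2H·φ of |φ|² over (0,T), using φ(T) = 0. Besides φ in L²(0,T)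
this controls φ(0), which multiplies the initial data. -/
theorem backwardSolution_energy (l : ℝ) {T : ℝ} (hT : 0 < T) {H : ℝ → C3} (hH : Continuous H) :
    l * timeNorm T (backwardSolution l T H) ^ 2 + 1 / 2 * ‖backwardSolution l T H 0‖ ^ 2 =
      ∫ t in Ioo 0 T, inner ℝ (H t) (backwardSolution l T H t) := by
  set φ := backwardSolution l T H
  have hφ : Continuous φ := continuous_backwardSolution l T hH
  have hd : ∀ t, HasDerivAt (fun t => ‖φ t‖ ^ 2)
      (2 * (l * ‖φ t‖ ^ 2) - 2 * inner ℝ (H t) (φ t)) t := fun t => by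
    refine (hasDerivAt_backwardSolution l T hH t).norm_sq.congr_deriv ?_
    rw [inner_sub_right, inner_smul_right, real_inner_self_eq_norm_sq, real_inner_comm]
    ring
  have c1 : Continuous fun t => 2 * (l * ‖φ t‖ ^ 2) := by fun_prop
  have c2 : Continuous fun t => 2 * inner ℝ (H t) (φ t) := by fun_prop
  have h := intervalIntegral.integral_eq_sub_of_hasDerivAt (a := 0) (b := T) (fun t _ => hd t)
    ((c1.sub c2).intervalIntegrable _ _)
  rw [intervalIntegral.integral_sub (c1.intervalIntegrable _ _) (c2.intervalIntegrable _ _)] at h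
  simp only [intervalIntegral_eq_Ioo hT, integral_const_mul] at h
  rw [← timeNorm_sq, show φ T = 0 from backwardSolution_end l T H] at h
  simp only [norm_zero] at h
  linarith

theorem isTest_testField {T : ℝ} (h : 𝓢(R3, ℝ)) {φ φ' : ℝ → C3}
    (hφ' : Continuous φ') (hd : ∀ t, HasDerivAt φ (φ' t) t) (hend : φ T = 0) :
    IsTest T (fun t => testField h (φ t)) (fun t => testField h (φ' t)) := by
  refine ⟨⟨memLp_Ioo_of_continuous (by fun_prop) T 2,
    Eventually.of_forall fun t => testField_mem h _, fun j => ?_⟩, fun t _ => ?_⟩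
  · simp_rw [weakGrad_testField]
    exact memLp_Ioo_of_continuous (by fun_prop) T 2
  · have h1 : ∫ s in t..T, testField h (φ' s) = testField h (φ T) - testField h (φ t) :=
      intervalIntegral.integral_eq_sub_of_hasDerivAt
        (fun s _ => (testField h).hasFDerivAt.comp_hasDerivAt s (hd s))
        (((testField h).continuous.comp hφ').intervalIntegrable _ _)
    rw [h1, hend, map_zero, zero_sub, neg_neg]

/-- `v ↦ ∫ g(y) v̂(2πy) dy` for a Schwartz function `g`. -/
def schwartzAvg (g : 𝓢(R3, ℝ)) : L2 →L[ℝ] C3 := fourierAvg (g.toLp 2)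

theorem schwartzAvg_sub_smul (g g' : 𝓢(R3, ℝ)) (c : ℝ) (v : L2) :
    schwartzAvg (g - c • g') v = schwartzAvg g v - c • schwartzAvg g' v := by
  have : (g - c • g').toLp 2 volume = g.toLp 2 volume - c • g'.toLp 2 volume := by
    have := map_sub (toLpCLM ℝ ℝ 2 (volume : Measure R3)) g (c • g')
    rw [map_smul] at this
    exact this
  simp only [schwartzAvg, this, fourierAvg, map_sub, map_smul]
  rfl

theorem memLp_two_of_top {F : Type*} [NormedAddCommGroup F] {T : ℝ} {f : ℝ → F}
    (hf : MemLp f ∞ (volume.restrict (Ioo 0 T))) : MemLp f 2 (volume.restrict (Ioo 0 T)) :=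
  hf.mono_exponent le_top

/-- Test with `testField h φ`, where φ solves the backward equation. The damping term of φ' cancels
the k2 part of the viscous term, so only the pairing with H and the error kernel |2πy|² - k2 survive
on the left. Everything else is estimated by Cauchy–Schwarz in time. The fields p, q, r, s allow one
proof for both equations. -/
theorem integral_inner_schwartzAvg_le {ν k2 T : ℝ} (hν : 0 ≤ ν) (hT : 0 < T)
    {v p q r s f : ℝ → L2} {v₀ : L2}
    (hvσ : IsLinftyL2 T v) (hv : IsL2H1 T v) (hf : IsLinftyL2 T f) (hv₀ : v₀ ∈ L2sigma)
    (hp : IsL2H1 T p) (hq : IsL2H1 T q) (hr : IsL2H1 T r) (hs : IsL2H1 T s)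
    (heq : ∀ Φ φ : ℝ → L2, IsTest T Φ φ →
      ∫ t in (0 : ℝ)..T, (- inner ℝ (v t) (φ t) + ν * gradInner (v t) (Φ t)
        + convection (p t) (q t) (Φ t) - convection (r t) (s t) (Φ t)) =
      inner ℝ v₀ (Φ 0) + ∫ t in (0 : ℝ)..T, inner ℝ (f t) (Φ t))
    {Γ : ℝ → ℝ} (hΓ : MemLp Γ 2 (volume.restrict (Ioo 0 T)))
    (hΓle : ∀ t ∈ Ioo 0 T,
      ‖p t‖ * √(gradNormSq (q t)) + ‖r t‖ * √(gradNormSq (s t)) ≤ Γ t)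
    (h : 𝓢(R3, ℝ)) (hh : ∫ y, |mulSq h y| ≤ 1) {H : ℝ → C3} (hH : Continuous H) :
    ∫ t in Ioo 0 T, inner ℝ (schwartzAvg (mulSq h) (v t)) (H t) ≤
      ‖schwartzAvg (mulSq h) v₀‖ * ‖backwardSolution (ν * k2) T H 0‖ +
      (timeNorm T (fun t => schwartzAvg (mulSq h) (f t)) +
        ν * timeNorm T (fun t => schwartzAvg (mulSq (mulSq h) - k2 • mulSq h) (v t)) +
        timeNorm T Γ) * timeNorm T (backwardSolution (ν * k2) T H) := by
  set φ := backwardSolution (ν * k2) T H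
  set A := schwartzAvg (mulSq h)
  set E := schwartzAvg (mulSq (mulSq h) - k2 • mulSq h)
  have hφ : Continuous φ := continuous_backwardSolution _ T hH
  have hφ2 : MemLp φ 2 (volume.restrict (Ioo 0 T)) := memLp_Ioo_of_continuous hφ T 2
  have hH2 : MemLp H 2 (volume.restrict (Ioo 0 T)) := memLp_Ioo_of_continuous hH T 2
  have hAv : MemLp (fun t => A (v t)) 2 (volume.restrict (Ioo 0 T)) := A.comp_memLp' hv.1
  have hEv : MemLp (fun t => E (v t)) 2 (volume.restrict (Ioo 0 T)) := E.comp_memLp' hv.1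
  have hAf : MemLp (fun t => A (f t)) 2 (volume.restrict (Ioo 0 T)) :=
    A.comp_memLp' (memLp_two_of_top hf.1)
  have hmc : ∀ {p q : ℝ → L2}, IsL2H1 T p → IsL2H1 T q →
      AEStronglyMeasurable (fun t => convection (p t) (q t) (testField h (φ t)))
        (volume.restrict (Ioo 0 T)) := fun hp hq =>
    aestronglyMeasurable_convection h hp.1.1 (fun j => (hq.2.2 j).1) hφ.aestronglyMeasurable
  have hΓφ : Integrable (fun t => ‖Γ t‖ * ‖φ t‖) (volume.restrict (Ioo 0 T)) :=
    hΓ.norm.integrable_mul hφ2.norm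
  have hcb : ∀ᵐ t ∂(volume.restrict (Ioo 0 T)),
      ‖convection (p t) (q t) (testField h (φ t)) - convection (r t) (s t) (testField h (φ t))‖ ≤
        ‖Γ t‖ * ‖φ t‖ := by
    filter_upwards [ae_restrict_mem measurableSet_Ioo] with t ht
    have h1 := abs_convection_testField_le (p t) (q t) h (φ t)
    have h2 := abs_convection_testField_le (r t) (s t) h (φ t)
    have h3 : (∫ y, |mulSq h y|) * ‖φ t‖ ≤ ‖φ t‖ :=
      mul_le_of_le_one_left (norm_nonneg _) hh
    calc _ ≤ _ := norm_sub_le _ _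
      _ ≤ ‖p t‖ * √(gradNormSq (q t)) * ‖φ t‖ + ‖r t‖ * √(gradNormSq (s t)) * ‖φ t‖ :=
        add_le_add (h1.trans (by gcongr)) (h2.trans (by gcongr))
      _ = (‖p t‖ * √(gradNormSq (q t)) + ‖r t‖ * √(gradNormSq (s t))) * ‖φ t‖ := by ring
      _ ≤ Γ t * ‖φ t‖ := by gcongr; exact hΓle t ht
      _ ≤ _ := by gcongr; exact le_abs_self _
  have hci : Integrable (fun t => convection (p t) (q t) (testField h (φ t)) -
      convection (r t) (s t) (testField h (φ t))) (volume.restrict (Ioo 0 T)) :=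
    hΓφ.mono' ((hmc hp hq).sub (hmc hr hs)) hcb
  have key := heq _ _ (isTest_testField h
    (φ' := fun t => (ν * k2) • φ t - H t) (by fun_prop)
    (hasDerivAt_backwardSolution (ν * k2) T hH) (backwardSolution_end _ T H))
  rw [intervalIntegral_eq_Ioo hT, intervalIntegral_eq_Ioo hT, inner_testField hv₀] at key
  have e1 : ∫ t in Ioo 0 T, (- inner ℝ (v t) (testField h ((ν * k2) • φ t - H t)) +
        ν * gradInner (v t) (testField h (φ t))
        + convection (p t) (q t) (testField h (φ t))
        - convection (r t) (s t) (testField h (φ t))) =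
      ∫ t in Ioo 0 T, ((inner ℝ (A (v t)) (H t) + ν * inner ℝ (E (v t)) (φ t)) +
        (convection (p t) (q t) (testField h (φ t))
        - convection (r t) (s t) (testField h (φ t)))) := by
    refine integral_congr_ae ?_
    filter_upwards [hvσ.2, hv.2.1] with t h1 h2
    have hA : fourierAvg ((mulSq h).toLp 2) = A := rfl
    have hE : E (v t) = fourierAvg ((mulSq (mulSq h)).toLp 2) (v t) - k2 • A (v t) :=
      schwartzAvg_sub_smul _ _ _ _
    rw [inner_testField h1, gradInner_testField h2, hA, hE, inner_sub_left, inner_sub_right,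
      real_inner_smul_left, real_inner_smul_right]
    ring
  have e2 : ∫ t in Ioo 0 T, inner ℝ (f t) (testField h (φ t)) =
      ∫ t in Ioo 0 T, inner ℝ (A (f t)) (φ t) := by
    refine integral_congr_ae ?_
    filter_upwards [hf.2] with t h1
    exact inner_testField h1 h (φ t)
  have hi : Integrable (fun t => inner ℝ (A (v t)) (H t) + ν * inner ℝ (E (v t)) (φ t))
      (volume.restrict (Ioo 0 T)) := (integrable_inner_of_memLp hAv hH2).add
    ((integrable_inner_of_memLp hEv hφ2).const_mul ν)
  rw [e1, e2, integral_add hi hci,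
    integral_add (integrable_inner_of_memLp hAv hH2)
    ((integrable_inner_of_memLp hEv hφ2).const_mul ν), integral_const_mul] at key
  have b0 : inner ℝ (fourierAvg ((mulSq h).toLp 2) v₀) (φ 0) ≤ ‖A v₀‖ * ‖φ 0‖ :=
    real_inner_le_norm _ _
  have b1 := (abs_le.1 (abs_integral_inner_le hAf hφ2)).2
  have b2 := (abs_le.1 (abs_integral_inner_le hEv hφ2)).1
  have b3 := (abs_le.1 ((norm_integral_le_of_norm_le hΓφ hcb).trans
    (integral_norm_mul_norm_le hΓ hφ2))).1
  have b4 := mul_le_mul_of_nonneg_left b2 hν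
  linarith

/-! ### The energy estimate for averages in Fourier space -/

/-- Let p, q be the Euclidean norms of (p₁,p₂), (q₁,q₂), and C = F + max(ν,η) e + √2 G.
Cauchy–Schwarz over the two equations gives I₁ + I₂ ≤ √2 a q + C p and min(ν,η) k2 p² + q²/2 ≤ n p.
After multiplication by βp, the cross term √2 a p β q is at most a²p² + β²q²/2, and the condition on
β absorbs the rest. The factors √2 arise because both equations share a and G. -/
theorem pair_estimate {I₁ I₂ a q₁ q₂ p₁ p₂ F₁ F₂ F e₁ e₂ e G ν η k2 n β : ℝ}
    (hν : 0 < ν) (hη : 0 < η) (hk2 : 0 < k2) (ha : 0 ≤ a)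
    (hp₁ : 0 ≤ p₁) (hp₂ : 0 ≤ p₂) (hF : 0 ≤ F) (he : 0 ≤ e) (he₁ : 0 ≤ e₁) (he₂ : 0 ≤ e₂)
    (hG : 0 ≤ G) (hn : 0 ≤ n)
    (h₁ : I₁ ≤ a * q₁ + (F₁ + ν * e₁ + G) * p₁) (h₂ : I₂ ≤ a * q₂ + (F₂ + η * e₂ + G) * p₂)
    (hFF : F₁ ^ 2 + F₂ ^ 2 ≤ F ^ 2) (hee : e₁ ^ 2 + e₂ ^ 2 ≤ e ^ 2)
    (hJ : (ν * k2 * p₁ ^ 2 + 1 / 2 * q₁ ^ 2) + (η * k2 * p₂ ^ 2 + 1 / 2 * q₂ ^ 2) ≤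
      n * √(p₁ ^ 2 + p₂ ^ 2))
    (hβ : 0 < β)
    (hβ2 : (F + max ν η * e + √2 * G) * β + a ^ 2 ≤ min ν η * k2 * β ^ 2) :
    I₁ + I₂ ≤ β * n := by
  set p := √(p₁ ^ 2 + p₂ ^ 2)
  have hp : 0 ≤ p := Real.sqrt_nonneg _
  have hpp : p ^ 2 = p₁ ^ 2 + p₂ ^ 2 := Real.sq_sqrt (by positivity)
  set q := √(q₁ ^ 2 + q₂ ^ 2)
  have hq : 0 ≤ q := Real.sqrt_nonneg _
  have hqq : q ^ 2 = q₁ ^ 2 + q₂ ^ 2 := Real.sq_sqrt (by positivity)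
  have hs2 : √2 ^ 2 = (2 : ℝ) := Real.sq_sqrt (by norm_num)
  have hs : 0 ≤ √2 := Real.sqrt_nonneg _
  have cs : ∀ x y z w r s : ℝ, 0 ≤ r → 0 ≤ s → x ^ 2 + y ^ 2 ≤ r ^ 2 → z ^ 2 + w ^ 2 ≤ s ^ 2 →
      x * z + y * w ≤ r * s := by
    intro x y z w r s hr hs h1 h2
    refine abs_le_of_sq_le_sq' ?_ (mul_nonneg hr hs) |>.2
    calc (x * z + y * w) ^ 2 ≤ (x ^ 2 + y ^ 2) * (z ^ 2 + w ^ 2) := by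
          nlinarith [sq_nonneg (x * w - y * z)]
      _ ≤ r ^ 2 * s ^ 2 := by gcongr
      _ = _ := by ring
  have b1 := cs F₁ F₂ p₁ p₂ F p hF hp hFF hpp.ge
  have b2 := cs e₁ e₂ p₁ p₂ e p he hp hee hpp.ge
  have b3 := cs 1 1 p₁ p₂ (√2) p hs hp (by rw [hs2]; norm_num) hpp.ge
  have b4 := cs 1 1 q₁ q₂ (√2) q hs hq (by rw [hs2]; norm_num) hqq.ge
  have b2' : ν * e₁ * p₁ + η * e₂ * p₂ ≤ max ν η * e * p := by
    have h1 : ν * (e₁ * p₁) ≤ max ν η * (e₁ * p₁) := by gcongr; exact le_max_left _ _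
    have h2 : η * (e₂ * p₂) ≤ max ν η * (e₂ * p₂) := by gcongr; exact le_max_right _ _
    have h3 : max ν η * (e₁ * p₁ + e₂ * p₂) ≤ max ν η * (e * p) := by
      gcongr
    linarith
  have hI : I₁ + I₂ ≤ √2 * a * q + (F + max ν η * e + √2 * G) * p := by
    have h3 := mul_le_mul_of_nonneg_left b3 hG
    have h4 := mul_le_mul_of_nonneg_left b4 ha
    linarith
  have hJ' : min ν η * k2 * p ^ 2 + 1 / 2 * q ^ 2 ≤ n * p := by
    have h1 : min ν η * (k2 * p₁ ^ 2) ≤ ν * (k2 * p₁ ^ 2) := by gcongr; exact min_le_left _ _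
    have h2 : min ν η * (k2 * p₂ ^ 2) ≤ η * (k2 * p₂ ^ 2) := by gcongr; exact min_le_right _ _
    rw [hpp, hqq]
    linarith
  have hm : 0 < min ν η * k2 := mul_pos (lt_min hν hη) hk2
  -- The main argument divides by βp. If p = 0, then q = 0 as well and the left side is nonpositive.
  rcases hp.eq_or_lt with h0 | hp0
  · rw [← h0] at hJ' hI
    have : q = 0 := by
      have : q ^ 2 ≤ 0 := by linarith
      exact pow_eq_zero_iff two_ne_zero |>.1 (le_antisymm this (sq_nonneg q))
    rw [this] at hI
    have := mul_nonneg hβ.le hn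
    linarith
  set C := F + max ν η * e + √2 * G
  refine hI.trans (le_of_mul_le_mul_left ?_ (mul_pos hβ hp0))
  have s1 : 0 ≤ (a * p * √2 - β * q) ^ 2 := sq_nonneg _
  have s2 := mul_le_mul_of_nonneg_right hβ2 (sq_nonneg p)
  have s3 := mul_le_mul_of_nonneg_left hJ' (sq_nonneg β)
  have s4 : (a * p * √2 - β * q) ^ 2 = 2 * (a * p) ^ 2 - 2 * (a * p * β * q) * √2 + (β * q) ^ 2 := by
    linear_combination (a * p) ^ 2 * hs2
  rw [s4] at s1
  linarith

theorem timeNorm_eq_toReal {F : Type*} [NormedAddCommGroup F] {T : ℝ} {f : ℝ → F}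
    (hf : MemLp f 2 (volume.restrict (Ioo 0 T))) :
    timeNorm T f = (eLpNorm f 2 (volume.restrict (Ioo 0 T))).toReal := by
  rw [hf.eLpNorm_eq_integral_rpow_norm two_ne_zero ENNReal.ofNat_ne_top, timeNorm,
    Real.sqrt_eq_rpow, ENNReal.toReal_ofReal (by positivity)]
  simp

theorem timeNorm_add_le {F : Type*} [NormedAddCommGroup F] {T : ℝ} {f g : ℝ → F}
    (hf : MemLp f 2 (volume.restrict (Ioo 0 T))) (hg : MemLp g 2 (volume.restrict (Ioo 0 T))) :
    timeNorm T (f + g) ≤ timeNorm T f + timeNorm T g := by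
  rw [timeNorm_eq_toReal hf, timeNorm_eq_toReal hg, timeNorm_eq_toReal (hf.add hg),
    ← ENNReal.toReal_add hf.2.ne hg.2.ne]
  exact ENNReal.toReal_mono (ENNReal.add_ne_top.2 ⟨hf.2.ne, hg.2.ne⟩)
    (eLpNorm_add_le hf.1 hg.1 (by norm_num))

theorem exists_continuous_timeNorm_sub_le {F : Type*} [NormedAddCommGroup F] [NormedSpace ℝ F]
    {T : ℝ} {f : ℝ → F} (hf : MemLp f 2 (volume.restrict (Ioo 0 T))) {ε : ℝ} (hε : 0 < ε) :
    ∃ g : ℝ → F, Continuous g ∧ timeNorm T (f - g) ≤ ε ∧ timeNorm T g ≤ timeNorm T f + ε := by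
  obtain ⟨g, -, hg, hgc, hgL⟩ := hf.exists_hasCompactSupport_eLpNorm_sub_le ENNReal.ofNat_ne_top
    (ε := ENNReal.ofReal ε) (by simpa using hε)
  have h1 : timeNorm T (f - g) ≤ ε := by
    rw [timeNorm_eq_toReal (hf.sub hgL)]
    exact ENNReal.toReal_le_of_le_ofReal hε.le hg
  have h2 : timeNorm T (g - f) = timeNorm T (f - g) := by
    simp only [timeNorm, Pi.sub_apply, norm_sub_rev]
  refine ⟨g, hgc, h1, ?_⟩
  calc timeNorm T g = timeNorm T (f + (g - f)) := by rw [add_sub_cancel]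
    _ ≤ timeNorm T f + timeNorm T (g - f) := timeNorm_add_le hf (hgL.sub hf)
    _ ≤ _ := by rw [h2]; linarith

/-- Taking for H, K continuous approximations of f, g makes the left side nearly S² and the right
side nearly βS. Continuity is imposed because the backward equation is solved classically. -/
theorem pair_norm_le_of_duality {F : Type*} [NormedAddCommGroup F] [InnerProductSpace ℝ F]
    {T β : ℝ} (hβ : 0 ≤ β) {f g : ℝ → F}
    (hf : MemLp f 2 (volume.restrict (Ioo 0 T))) (hg : MemLp g 2 (volume.restrict (Ioo 0 T)))
    (h : ∀ H K : ℝ → F, Continuous H → Continuous K →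
      (∫ t in Ioo 0 T, inner ℝ (f t) (H t)) + (∫ t in Ioo 0 T, inner ℝ (g t) (K t)) ≤
        β * √(timeNorm T H ^ 2 + timeNorm T K ^ 2)) (hc : ∀ H : ℝ → F, Continuous H →
          MemLp H 2 (volume.restrict (Ioo 0 T))) :
    √(timeNorm T f ^ 2 + timeNorm T g ^ 2) ≤ β := by
  set S := √(timeNorm T f ^ 2 + timeNorm T g ^ 2)
  have hS : 0 ≤ S := Real.sqrt_nonneg _
  have hSS : S ^ 2 = timeNorm T f ^ 2 + timeNorm T g ^ 2 := Real.sq_sqrt (by positivity)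
  have hf0 := timeNorm_nonneg T f
  have hg0 := timeNorm_nonneg T g
  have key : ∀ ε > 0, S ^ 2 ≤ β * S + ε * (2 * β + timeNorm T f + timeNorm T g) := by
    intro ε hε
    obtain ⟨H, hH, hH1, hH2⟩ := exists_continuous_timeNorm_sub_le hf hε
    obtain ⟨K, hK, hK1, hK2⟩ := exists_continuous_timeNorm_sub_le hg hε
    have aux : ∀ {f H : ℝ → F}, MemLp f 2 (volume.restrict (Ioo 0 T)) → Continuous H →
        timeNorm T (f - H) ≤ ε →
        timeNorm T f ^ 2 ≤ (∫ t in Ioo 0 T, inner ℝ (f t) (H t)) + timeNorm T f * ε := by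
      intro f H hf hH h1
      have hd := hf.sub (hc H hH)
      have e : timeNorm T f ^ 2 = (∫ t in Ioo 0 T, inner ℝ (f t) (H t)) +
          ∫ t in Ioo 0 T, inner ℝ (f t) ((f - H) t) := by
        rw [timeNorm_sq, ← integral_add (integrable_inner_of_memLp hf (hc H hH))
          (integrable_inner_of_memLp hf hd)]
        congr 1
        ext t
        rw [← inner_add_right, Pi.sub_apply, add_sub_cancel, real_inner_self_eq_norm_sq]
      rw [e]
      have := (abs_le.1 (abs_integral_inner_le hf hd)).2
      have := mul_le_mul_of_nonneg_left h1 (timeNorm_nonneg T f)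
      linarith
    have h1 := aux hf hH hH1
    have h2 := aux hg hK hK1
    have h3 := h H K hH hK
    have h4 : √(timeNorm T H ^ 2 + timeNorm T K ^ 2) ≤ S + 2 * ε := by
      refine Real.sqrt_le_iff.2 ⟨by positivity, ?_⟩
      have hfS : timeNorm T f ≤ S := Real.le_sqrt_of_sq_le (by nlinarith)
      have hgS : timeNorm T g ≤ S := Real.le_sqrt_of_sq_le (by nlinarith)
      have a1 := pow_le_pow_left₀ (timeNorm_nonneg T H) hH2 2
      have a2 := pow_le_pow_left₀ (timeNorm_nonneg T K) hK2 2
      nlinarith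
    have h5 := mul_le_mul_of_nonneg_left h4 hβ
    nlinarith
  have h1 : S ^ 2 ≤ β * S := by
    refine le_of_forall_pos_le_add fun δ hδ => ?_
    set D := 2 * β + timeNorm T f + timeNorm T g
    have hD : 0 ≤ D := by positivity
    refine (key (δ / (D + 1)) (by positivity)).trans ?_
    gcongr
    rw [div_mul_eq_mul_div, div_le_iff₀ (by positivity)]
    nlinarith
  rcases hS.eq_or_lt with h0 | h0
  · rw [← h0]; exact hβ
  · nlinarith

/-! ### Averaging kernels near a wave vector -/

/-- Averaging kernels supported in the ball of radius `ρ` about `y₀`, of size at most `L`. -/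
structure IsKernel (y₀ : R3) (ρ L : ℝ) (g : 𝓢(R3, ℝ)) : Prop where
  support : ∀ y, g y ≠ 0 → ‖y - y₀‖ ≤ ρ
  bound : ∀ y, |g y| ≤ L
  mass : ∫ y, |g y| ≤ 1

/-- Since ρ < |y₀|, the kernel vanishes near the origin, and dividing it by |2πy|² keeps it smooth.
-/
theorem IsKernel.exists_mulSq_eq {y₀ : R3} {ρ L : ℝ} {g : 𝓢(R3, ℝ)} (hg : IsKernel y₀ ρ L g)
    (hρ : ρ < ‖y₀‖) : ∃ h : 𝓢(R3, ℝ), mulSq h = g := by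
  let f : R3 → ℝ := fun y => ((2 * Real.pi) ^ 2 * ‖y‖ ^ 2)⁻¹ * g y
  have h0 : ∀ᶠ y in 𝓝 (0 : R3), g y = 0 := by
    have : ∀ᶠ y in 𝓝 (0 : R3), ρ < ‖y - y₀‖ :=
      continuousAt_const.eventually_lt (by fun_prop) (by simpa using hρ)
    filter_upwards [this] with y hy
    by_contra h
    exact absurd (hg.support y h) (not_le.2 hy)
  have hc : HasCompactSupport f := by
    refine HasCompactSupport.intro (isCompact_closedBall y₀ ρ) fun y hy => ?_
    have : g y = 0 := by
      by_contra h
      exact hy (by simpa [dist_eq_norm] using hg.support y h)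
    simp [f, this]
  have hs : ContDiff ℝ ∞ f := by
    rw [contDiff_iff_contDiffAt]
    intro y
    by_cases hy : y = 0
    · subst hy
      refine (contDiffAt_const (c := (0 : ℝ))).congr_of_eventuallyEq ?_
      filter_upwards [h0] with y hy
      simp [f, hy]
    · refine ContDiffAt.mul (ContDiffAt.inv ?_ ?_) (g.smooth ⊤).contDiffAt
      · exact contDiffAt_const.mul (contDiff_norm_sq ℝ).contDiffAt
      · have := norm_pos_iff.2 hy
        positivity
  refine ⟨hc.toSchwartzMap hs, ?_⟩
  ext y
  rw [mulSq_apply]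
  change (2 * Real.pi) ^ 2 * ‖y‖ ^ 2 * (((2 * Real.pi) ^ 2 * ‖y‖ ^ 2)⁻¹ * g y) = g y
  by_cases hy : y = 0
  · rw [hy, h0.self_of_nhds]; simp
  · have := norm_pos_iff.2 hy
    field_simp

/-- On the support, ||y|² - |y₀|²| ≤ ρ(|y| + |y₀|) ≤ 3|y₀|ρ. Thus the error kernel is a small
multiple of a kernel with the same y₀, ρ and L. -/
theorem IsKernel.mulSq_sub {y₀ : R3} {ρ L : ℝ} {g : 𝓢(R3, ℝ)} (hg : IsKernel y₀ ρ L g)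
    (hρ0 : 0 < ρ) (hρ : ρ < ‖y₀‖) :
    IsKernel y₀ ρ L (((2 * Real.pi) ^ 2 * (3 * ‖y₀‖ * ρ))⁻¹ •
      (mulSq g - ((2 * Real.pi) ^ 2 * ‖y₀‖ ^ 2) • g)) := by
  set e := (2 * Real.pi) ^ 2 * (3 * ‖y₀‖ * ρ)
  have hy0 : 0 < ‖y₀‖ := hρ0.trans hρ
  have he : 0 < e := by positivity
  set g' := e⁻¹ • (mulSq g - ((2 * Real.pi) ^ 2 * ‖y₀‖ ^ 2) • g)
  have happ : ∀ y, g' y = (e⁻¹ * ((2 * Real.pi) ^ 2 * (‖y‖ ^ 2 - ‖y₀‖ ^ 2))) * g y := by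
    intro y
    simp only [g', smul_apply, sub_apply, mulSq_apply, smul_eq_mul]
    ring
  have hle : ∀ y, |g' y| ≤ |g y| := by
    intro y
    by_cases hy : g y = 0
    · rw [happ, hy, mul_zero]
    · have h1 := hg.support y hy
      rw [happ, abs_mul]
      refine mul_le_of_le_one_left (abs_nonneg _) ?_
      have h2 := abs_le.1 (abs_norm_sub_norm_le y y₀)
      rw [abs_mul, abs_mul, abs_inv, abs_of_pos he, abs_of_nonneg (by positivity : 0 ≤ (2 * Real.pi) ^ 2)]
      rw [inv_mul_le_iff₀ he, mul_one]
      refine mul_le_mul_of_nonneg_left ?_ (by positivity)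
      rw [abs_le]
      have := norm_nonneg y
      constructor <;> nlinarith
  refine ⟨fun y hy => hg.support y fun h => hy (by rw [happ, h, mul_zero]),
    fun y => (hle y).trans (hg.bound y), ?_⟩
  exact (integral_mono g'.integrable.norm g.integrable.norm hle).trans hg.mass

theorem schwartzAvg_apply (g : 𝓢(R3, ℝ)) (v : L2) :
    schwartzAvg g v = ∫ y, g y • fourierField v y := by
  rw [schwartzAvg, fourierAvg_apply]
  refine integral_congr_ae ?_
  filter_upwards [g.coeFn_toLp 2 volume] with y hy
  rw [hy]

theorem IsKernel.norm_schwartzAvg_le {y₀ : R3} {ρ L : ℝ} {g : 𝓢(R3, ℝ)}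
    (hg : IsKernel y₀ ρ L g) {v : L2} {a : ℝ} (ha : 0 ≤ a)
    (h : ∀ᵐ y, ‖y - y₀‖ ≤ ρ → ‖fourierField v y‖ ≤ a) : ‖schwartzAvg g v‖ ≤ a := by
  rw [schwartzAvg_apply]
  have hb : ∀ᵐ y, ‖g y • fourierField v y‖ ≤ |g y| * a := by
    filter_upwards [h] with y hy
    rw [norm_smul, Real.norm_eq_abs]
    by_cases hgy : g y = 0
    · simp [hgy]
    · gcongr
      exact hy (hg.support y hgy)
  refine (norm_integral_le_of_norm_le (g.integrable.norm.mul_const a) hb).trans ?_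
  rw [integral_mul_const]
  exact mul_le_of_le_one_left ha hg.mass

/-- Plancherel together with ∫ g² ≤ L ∫ |g| ≤ L. Only the finiteness of C matters: it makes the
supremum over all kernels finite. -/
theorem exists_norm_schwartzAvg_le (y₀ : R3) (ρ L : ℝ) :
    ∃ C, 0 ≤ C ∧ ∀ g, IsKernel y₀ ρ L g → ∀ v, ‖schwartzAvg g v‖ ≤ C * ‖v‖ := by
  set B := (ContinuousLinearMap.lsmul ℝ ℝ : ℝ →L[ℝ] C3 →L[ℝ] C3).lpPairing
    (volume : Measure R3) 2 2
  refine ⟨‖B‖ * √L, by positivity, fun g hg v => ?_⟩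
  have h1 : ‖g.toLp 2 volume‖ ≤ √L := by
    refine Real.le_sqrt_of_sq_le ?_
    rw [← real_inner_self_eq_norm_sq, L2.inner_def]
    have e : ∫ y, inner ℝ (g.toLp 2 volume y) (g.toLp 2 volume y) = ∫ y, |g y| ^ 2 := by
      refine integral_congr_ae ?_
      filter_upwards [g.coeFn_toLp 2 volume] with y hy
      rw [hy, real_inner_self_eq_norm_sq, Real.norm_eq_abs]
    rw [e]
    have hL : 0 ≤ L := (abs_nonneg _).trans (hg.bound 0)
    have hsq : Integrable fun y => |g y| ^ 2 := (g.memLp 2 volume).integrable_norm_pow two_ne_zero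
    calc ∫ y, |g y| ^ 2 ≤ ∫ y, L * |g y| := by
          refine integral_mono hsq (g.integrable.norm.const_mul L) fun y => ?_
          simp only [pow_two]
          gcongr
          exact hg.bound y
      _ ≤ L := by
          rw [integral_const_mul]
          exact mul_le_of_le_one_right hL hg.mass
  calc ‖schwartzAvg g v‖ ≤ ‖B‖ * ‖g.toLp 2 volume‖ * ‖fourierField v‖ := B.le_opNorm₂ _ _
    _ ≤ ‖B‖ * √L * ‖v‖ := by rw [norm_fourierField]; gcongr

/-- If the conclusion failed at M, the quadratic condition would by continuity hold at some positive
β < M, contradicting M ≤ β. -/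
theorem sq_le_of_forall_root_le {l C D M : ℝ} (hD : 0 ≤ D) (hM : 0 ≤ M)
    (h : ∀ β > 0, C * β + D ≤ l * β ^ 2 → M ≤ β) : l * M ^ 2 ≤ C * M + D := by
  by_contra hlt
  rw [not_le] at hlt
  have hM0 : 0 < M := by
    rcases hM.eq_or_lt with h0 | h0
    · rw [← h0] at hlt; norm_num at hlt; linarith
    · exact h0
  have hc : ∀ᶠ β in 𝓝 M, C * β + D < l * β ^ 2 :=
    ContinuousAt.eventually_lt (by fun_prop) (by fun_prop) hlt
  have hc' : ∀ᶠ β in 𝓝[<] M, C * β + D < l * β ^ 2 ∧ 0 < β ∧ β < M :=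
    (hc.filter_mono nhdsWithin_le_nhds).and
      (((lt_mem_nhds hM0).filter_mono nhdsWithin_le_nhds).and self_mem_nhdsWithin)
  obtain ⟨β, h1, h2, h3⟩ := hc'.exists
  exact absurd (h β h2 h1.le) (not_le.2 h3)

theorem timeNorm_smul {F : Type*} [NormedAddCommGroup F] [NormedSpace ℝ F] (T c : ℝ) (f : ℝ → F) :
    timeNorm T (fun t => c • f t) ^ 2 = c ^ 2 * timeNorm T f ^ 2 := by
  rw [timeNorm_sq, timeNorm_sq, ← integral_const_mul]
  congr 1
  ext t
  rw [norm_smul, mul_pow, Real.norm_eq_abs, sq_abs]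

theorem timeNorm_le_of_norm_le {F G : Type*} [NormedAddCommGroup F] [NormedAddCommGroup G]
    {T : ℝ} {f : ℝ → F} {g : ℝ → G} {C : ℝ} (hC : 0 ≤ C)
    (hg : MemLp g 2 (volume.restrict (Ioo 0 T))) (h : ∀ t, ‖f t‖ ≤ C * ‖g t‖) :
    timeNorm T f ≤ C * timeNorm T g := by
  refine Real.sqrt_le_iff.2 ⟨mul_nonneg hC (timeNorm_nonneg _ _), ?_⟩
  rw [mul_pow, timeNorm_sq, ← integral_const_mul]
  refine integral_mono_of_nonneg (Eventually.of_forall fun t => by positivity)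
    ((hg.integrable_norm_pow two_ne_zero).const_mul _) (Eventually.of_forall fun t => ?_)
  simp only
  rw [← mul_pow]
  gcongr
  exact h t

/-- The `L²(0,T)` norm of a pair. -/
def pairNorm {F : Type*} [NormedAddCommGroup F] (T : ℝ) (f g : ℝ → F) : ℝ :=
  √(timeNorm T f ^ 2 + timeNorm T g ^ 2)

theorem memLp_gradNormSq {T : ℝ} {v w : ℝ → L2} (hv : IsL2H1 T v) (hw : IsL2H1 T w) :
    MemLp (fun t => √(gradNormSq (v t) + gradNormSq (w t))) 2 (volume.restrict (Ioo 0 T)) := by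
  have h1 : ∀ {v : ℝ → L2}, IsL2H1 T v →
      Integrable (fun t => gradNormSq (v t)) (volume.restrict (Ioo 0 T)) := fun hv =>
    integrable_finsetSum _ fun j _ => (hv.2.2 j).integrable_norm_pow two_ne_zero
  have h2 := (h1 hv).add (h1 hw)
  refine (memLp_two_iff_integrable_sq
    (Real.continuous_sqrt.comp_aestronglyMeasurable h2.aestronglyMeasurable)).2 ?_
  refine h2.congr (Eventually.of_forall fun t => ?_)
  exact (Real.sq_sqrt (add_nonneg (gradNormSq_nonneg _) (gradNormSq_nonneg _))).symm

/-- For one kernel the estimate involves the error kernel and does not close; for the supremum M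
over all kernels the error is at most a multiple of ρM. The bound L enters only through the
finiteness of M and is absent from the final inequality, so ρ may later tend to 0. -/
theorem exists_pairNorm_schwartzAvg_le {ν η : ℝ} (hν : 0 < ν) (hη : 0 < η) {f₁ f₂ : ℝ → L2}
    {u₀ b₀ : L2} {u b : ℝ → L2} (hsol : IsWeakSolution ν η f₁ f₂ u₀ b₀ u b)
    {T : ℝ} (hT : 0 < T) (hf₁ : IsLinftyL2 T f₁) (hf₂ : IsLinftyL2 T f₂) {R : ℝ} (hR0 : 0 ≤ R)
    (hR : ∀ t ∈ Ioo 0 T, ‖u t‖ ^ 2 + ‖b t‖ ^ 2 ≤ R ^ 2)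
    (hRT : min ν η * (∫ s in Ioo 0 T, (gradNormSq (u s) + gradNormSq (b s))) ≤ R ^ 2)
    {y₀ : R3} {ρ L a F : ℝ} (hρ0 : 0 < ρ) (hρ : ρ < ‖y₀‖) (ha : 0 ≤ a) (hF : 0 ≤ F)
    (hu₀ : ∀ᵐ y, ‖y - y₀‖ ≤ ρ → ‖fourierField u₀ y‖ ≤ a)
    (hb₀ : ∀ᵐ y, ‖y - y₀‖ ≤ ρ → ‖fourierField b₀ y‖ ≤ a)
    (hFg : ∀ g, IsKernel y₀ ρ L g → timeNorm T (fun t => schwartzAvg g (f₁ t)) ^ 2 +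
      timeNorm T (fun t => schwartzAvg g (f₂ t)) ^ 2 ≤ F ^ 2) :
    ∃ M, 0 ≤ M ∧ (∀ g, IsKernel y₀ ρ L g →
      pairNorm T (fun t => schwartzAvg g (u t)) (fun t => schwartzAvg g (b t)) ≤ M) ∧
      min ν η * ((2 * Real.pi) ^ 2 * ‖y₀‖ ^ 2) * M ^ 2 ≤
        (F + max ν η * ((2 * Real.pi) ^ 2 * (3 * ‖y₀‖ * ρ) * M) +
          √2 * (R ^ 2 / √(min ν η))) * M + a ^ 2 := by
  set k2 := (2 * Real.pi) ^ 2 * ‖y₀‖ ^ 2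
  set ε := (2 * Real.pi) ^ 2 * (3 * ‖y₀‖ * ρ)
  have hy0 : 0 < ‖y₀‖ := hρ0.trans hρ
  have hk2 : 0 < k2 := by positivity
  have hε : 0 < ε := by positivity
  have hm : 0 < min ν η := lt_min hν hη
  set X : 𝓢(R3, ℝ) → ℝ := fun g =>
    pairNorm T (fun t => schwartzAvg g (u t)) (fun t => schwartzAvg g (b t))
  have hu2 := (hsol.u_H1 T hT).1
  have hb2 := (hsol.b_H1 T hT).1
  have hXbdd : BddAbove (X '' {g | IsKernel y₀ ρ L g}) := by
    obtain ⟨C, hC, hCg⟩ := exists_norm_schwartzAvg_le y₀ ρ L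
    refine ⟨√((C * timeNorm T u) ^ 2 + (C * timeNorm T b) ^ 2), ?_⟩
    rintro _ ⟨g, hg, rfl⟩
    refine Real.sqrt_le_sqrt (add_le_add ?_ ?_)
    · exact pow_le_pow_left₀ (timeNorm_nonneg _ _)
        (timeNorm_le_of_norm_le hC hu2 fun t => hCg g hg _) 2
    · exact pow_le_pow_left₀ (timeNorm_nonneg _ _)
        (timeNorm_le_of_norm_le hC hb2 fun t => hCg g hg _) 2
  set M := sSup (X '' {g | IsKernel y₀ ρ L g})
  have hXM : ∀ g, IsKernel y₀ ρ L g → X g ≤ M := fun g hg => le_csSup hXbdd ⟨g, hg, rfl⟩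
  have hM0 : 0 ≤ M := Real.sSup_nonneg (by rintro _ ⟨g, _, rfl⟩; exact Real.sqrt_nonneg _)
  refine ⟨M, hM0, hXM, ?_⟩
  set Γ : ℝ → ℝ := fun t => R * √(gradNormSq (u t) + gradNormSq (b t))
  have hΓ : MemLp Γ 2 (volume.restrict (Ioo 0 T)) :=
    (memLp_gradNormSq (hsol.u_H1 T hT) (hsol.b_H1 T hT)).const_mul R
  have hΓn : timeNorm T Γ ≤ R ^ 2 / √(min ν η) := by
    refine Real.sqrt_le_iff.2 ⟨by positivity, ?_⟩
    have e : ∀ t, ‖Γ t‖ ^ 2 = R ^ 2 * (gradNormSq (u t) + gradNormSq (b t)) := fun t => by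
      rw [Real.norm_eq_abs, sq_abs, mul_pow, Real.sq_sqrt]
      exact add_nonneg (gradNormSq_nonneg _) (gradNormSq_nonneg _)
    simp_rw [e]
    rw [integral_const_mul, div_pow, Real.sq_sqrt hm.le, le_div_iff₀ hm]
    nlinarith [sq_nonneg R]
  -- Stated for abstract numbers because the induction equation pairs ‖u‖ with ‖∇b‖ and ‖b‖ with
  -- ‖∇u‖, while the momentum equation does not cross them.
  have hΓle : ∀ {x y x' y' : ℝ} (t), t ∈ Ioo 0 T → x ^ 2 + x' ^ 2 = ‖u t‖ ^ 2 + ‖b t‖ ^ 2 →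
      y ^ 2 + y' ^ 2 = gradNormSq (u t) + gradNormSq (b t) → x * y + x' * y' ≤ Γ t := by
    intro x y x' y' t ht h1 h2
    have h3 : (x * y + x' * y') ^ 2 ≤ R ^ 2 * (gradNormSq (u t) + gradNormSq (b t)) := by
      have h4 := hR t ht
      calc (x * y + x' * y') ^ 2 ≤ (x ^ 2 + x' ^ 2) * (y ^ 2 + y' ^ 2) := by
            nlinarith [sq_nonneg (x * y' - x' * y)]
        _ ≤ _ := by rw [h1, h2]; gcongr; rw [← h2]; positivity
    refine (abs_le_of_sq_le_sq' ?_ ?_).2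
    · refine h3.trans_eq ?_
      rw [mul_pow, Real.sq_sqrt]
      rw [← h2]; positivity
    · exact mul_nonneg hR0 (Real.sqrt_nonneg _)
  have hsq : ∀ v : L2, √(gradNormSq v) ^ 2 = gradNormSq v := fun v =>
    Real.sq_sqrt (gradNormSq_nonneg v)
  -- The error is frozen at its value for M. Each β admissible in the resulting quadratic condition
  -- bounds every kernel, hence M itself.
  refine sq_le_of_forall_root_le (by positivity) hM0 fun β hβ hβ2 => ?_
  refine Real.sSup_le ?_ hβ.le
  rintro _ ⟨g, hg, rfl⟩
  have hgk : IsKernel y₀ ρ L g := hg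
  obtain ⟨h, hh⟩ := hgk.exists_mulSq_eq hρ
  have hmass : ∫ y, |mulSq h y| ≤ 1 := by rw [hh]; exact hgk.mass
  refine pair_norm_le_of_duality hβ.le ((schwartzAvg g).comp_memLp' hu2)
    ((schwartzAvg g).comp_memLp' hb2) (fun H K hH hK => ?_)
    (fun H hH => memLp_Ioo_of_continuous hH T 2)
  have hgK := hgk.mulSq_sub hρ0 hρ
  have hE : ∀ v : L2, schwartzAvg (mulSq g - k2 • g) v =
      ε • schwartzAvg (ε⁻¹ • (mulSq g - k2 • g)) v := by
    intro v
    have h1 := schwartzAvg_sub_smul (mulSq g - k2 • g) (ε⁻¹ • (mulSq g - k2 • g)) ε v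
    rw [smul_smul, mul_inv_cancel₀ hε.ne', one_smul, sub_self] at h1
    have h0 : schwartzAvg (0 : 𝓢(R3, ℝ)) v = 0 := by
      rw [schwartzAvg_apply]; simp
    rw [h0] at h1
    exact (sub_eq_zero.1 h1.symm)
  have est₁ := integral_inner_schwartzAvg_le (k2 := k2) hν.le hT (hsol.u_bdd T hT) (hsol.u_H1 T hT)
    hf₁ hsol.u₀_mem (hsol.u_H1 T hT) (hsol.u_H1 T hT) (hsol.b_H1 T hT) (hsol.b_H1 T hT)
    (hsol.momentum T hT) hΓ (fun t ht => hΓle t ht rfl (by rw [hsq, hsq])) h hmass hH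
  have est₂ := integral_inner_schwartzAvg_le (k2 := k2) hη.le hT (hsol.b_bdd T hT) (hsol.b_H1 T hT)
    hf₂ hsol.b₀_mem (hsol.u_H1 T hT) (hsol.b_H1 T hT) (hsol.b_H1 T hT) (hsol.u_H1 T hT)
    (hsol.induction_eq T hT) hΓ (fun t ht => hΓle t ht rfl (by rw [hsq, hsq, add_comm])) h hmass hK
  rw [hh] at est₁ est₂
  set φ := backwardSolution (ν * k2) T H
  set ψ := backwardSolution (η * k2) T K
  refine pair_estimate (q₁ := ‖φ 0‖) (q₂ := ‖ψ 0‖)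
    (e₁ := timeNorm T fun t => schwartzAvg (mulSq g - k2 • g) (u t))
    (e₂ := timeNorm T fun t => schwartzAvg (mulSq g - k2 • g) (b t))
    hν hη hk2 ha (timeNorm_nonneg T φ)
    (timeNorm_nonneg T ψ) hF (mul_nonneg hε.le hM0) ?_ ?_
    (by positivity) (Real.sqrt_nonneg _) (est₁.trans ?_) (est₂.trans ?_) (hFg g hgk) ?_ ?_ hβ hβ2
  · exact timeNorm_nonneg T (fun t => schwartzAvg (mulSq g - k2 • g) (u t))
  · exact timeNorm_nonneg T (fun t => schwartzAvg (mulSq g - k2 • g) (b t))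
  · have := timeNorm_nonneg T φ
    gcongr
    exact hgk.norm_schwartzAvg_le ha hu₀
  · have := timeNorm_nonneg T ψ
    gcongr
    exact hgk.norm_schwartzAvg_le ha hb₀
  · simp_rw [hE]
    rw [timeNorm_smul, timeNorm_smul, ← mul_add, mul_pow ε M]
    refine mul_le_mul_of_nonneg_left ?_ (sq_nonneg ε)
    have h1 := hXM _ hgK
    have h2 := pow_le_pow_left₀ (Real.sqrt_nonneg _) h1 2
    refine le_trans (le_of_eq ?_) h2
    exact (Real.sq_sqrt (by positivity)).symm
  · rw [backwardSolution_energy _ hT hH, backwardSolution_energy _ hT hK]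
    have i1 := (abs_le.1 (abs_integral_inner_le (memLp_Ioo_of_continuous hH T 2)
      (memLp_Ioo_of_continuous (continuous_backwardSolution (ν * k2) T hH) T 2))).2
    have i2 := (abs_le.1 (abs_integral_inner_le (memLp_Ioo_of_continuous hK T 2)
      (memLp_Ioo_of_continuous (continuous_backwardSolution (η * k2) T hK) T 2))).2
    refine (add_le_add i1 i2).trans ?_
    rw [← Real.sqrt_mul (by positivity)]
    refine Real.le_sqrt_of_sq_le ?_
    nlinarith [sq_nonneg (timeNorm T H * timeNorm T ψ - timeNorm T K * timeNorm T φ)]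

/-! ### Cutoffs in Fourier space -/

theorem ae_comp_smul {P : R3 → Prop} {c : ℝ} (hc : c ≠ 0) (h : ∀ᵐ ξ, P ξ) :
    ∀ᵐ y, P (c • y) := by
  rw [ae_iff] at h ⊢
  have := Measure.addHaar_preimage_smul (volume : Measure R3) hc {ξ | ¬ P ξ}
  rw [h, mul_zero] at this
  exact this

theorem hat_eq (v : L2) (ξ : R3) : hat v ξ = fourierField v ((2 * Real.pi)⁻¹ • ξ) := rfl

/-- Chebyshev's inequality at a level S' > S bounds the measure of the exceptional set by (S/S')ⁿ,
which tends to 0; then S' decreases to S. This turns a bound on all e_p into an L^∞ bound. -/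
theorem ae_enorm_le_of_lintegral_pow_le {X E : Type*} [MeasurableSpace X] [NormedAddCommGroup E]
    {μ : Measure X} {f : X → E} (hf : AEStronglyMeasurable f μ) {S : ℝ≥0∞}
    (h : ∀ n : ℕ, 2 ≤ n → ∫⁻ x, ‖f x‖ₑ ^ n ∂μ ≤ S ^ n) : ∀ᵐ x ∂μ, ‖f x‖ₑ ≤ S := by
  rcases eq_or_ne S ⊤ with rfl | hS
  · simp
  have key : ∀ S', S < S' → S' ≠ ⊤ → ∀ᵐ x ∂μ, ‖f x‖ₑ ≤ S' := by
    intro S' h1 h2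
    have hS' : S' ≠ 0 := (zero_le.trans_lt h1).ne'
    have hlt : S / S' < 1 := by
      rw [ENNReal.div_lt_iff (Or.inl hS') (Or.inl h2), one_mul]
      exact h1
    have hle : ∀ n : ℕ, 2 ≤ n → μ {x | S' ≤ ‖f x‖ₑ} ≤ (S / S') ^ n := by
      intro n hn
      rw [ENNReal.div_eq_inv_mul, mul_pow, ← ENNReal.inv_pow, ← ENNReal.div_eq_inv_mul,
        ENNReal.le_div_iff_mul_le (Or.inl (pow_ne_zero _ hS')) (Or.inl (ENNReal.pow_ne_top h2)),
        mul_comm]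
      refine le_trans (mul_le_mul_right (measure_mono fun x hx => ?_) _)
        ((mul_meas_ge_le_lintegral₀ (hf.enorm.pow_const n) (S' ^ n)).trans (h n hn))
      have hx' : S' ≤ ‖f x‖ₑ := hx
      exact pow_le_pow_left₀ zero_le hx' n
    have h0 : μ {x | S' ≤ ‖f x‖ₑ} ≤ 0 :=
      ge_of_tendsto (ENNReal.tendsto_pow_atTop_nhds_zero_of_lt_one hlt)
        ((eventually_ge_atTop 2).mono hle)
    rw [ae_iff]
    exact measure_mono_null (fun x hx => (not_le.1 hx).le) (le_antisymm h0 zero_le)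
  obtain ⟨s, -, hs, hlim⟩ := exists_seq_strictAnti_tendsto' (lt_top_iff_ne_top.2 hS)
  have hall : ∀ᵐ x ∂μ, ∀ n, ‖f x‖ₑ ≤ s n :=
    ae_all_iff.2 fun n => key _ (hs n).1 (hs n).2.ne
  filter_upwards [hall] with x hx
  exact ge_of_tendsto' hlim hx

theorem aestronglyMeasurable_hat (v : L2) : AEStronglyMeasurable (hat v) volume :=
  (Lp.aestronglyMeasurable (fourierField v)).comp_quasiMeasurePreserving
    ⟨measurable_const_smul _, by
      refine Measure.AbsolutelyContinuous.mk fun s hs h0 => ?_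
      rw [Measure.map_apply (measurable_const_smul _) hs, Measure.addHaar_preimage_smul _
        (by have := Real.pi_pos; positivity), h0, mul_zero]⟩

theorem ae_enorm_le_of_ep_le {χ : R3 → R3 → ℝ} {κ : R3} (hχ : Continuous (χ κ)) {u b : L2}
    {S : ℝ≥0∞} (h : ∀ p : ℝ, 2 ≤ p → ep χ p κ u b ≤ S) :
    (∀ᵐ ξ, ‖χ κ ξ • hat u ξ‖ₑ ≤ S) ∧ ∀ᵐ ξ, ‖χ κ ξ • hat b ξ‖ₑ ≤ S := by
  have hpow : ∀ n : ℕ, 2 ≤ n →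
      ∫⁻ ξ, (‖χ κ ξ • hat u ξ‖ₑ ^ n + ‖χ κ ξ • hat b ξ‖ₑ ^ n) ≤ S ^ n := by
    intro n hn
    have h1 := h n (by exact_mod_cast hn)
    have hn0 : (0 : ℝ) < n := by exact_mod_cast (by omega : 0 < n)
    rw [ep, one_div, ENNReal.rpow_inv_le_iff hn0] at h1
    simpa using h1
  have hm : ∀ v : L2, AEStronglyMeasurable (fun ξ => χ κ ξ • hat v ξ) volume := fun v =>
    hχ.aestronglyMeasurable.smul (aestronglyMeasurable_hat v)
  exact ⟨ae_enorm_le_of_lintegral_pow_le (hm u) fun n hn =>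
      (lintegral_mono fun ξ => le_self_add).trans (hpow n hn),
    ae_enorm_le_of_lintegral_pow_le (hm b) fun n hn =>
      (lintegral_mono fun ξ => le_add_self).trans (hpow n hn)⟩

/-- After ξ = 2πy, the ball of radius ρ lies in the cube where the cutoff is 1. -/
theorem ae_enorm_fourierField_le {c : R3 → ℝ} {κ : R3} {d : ℝ}
    (hc : ∀ ξ : R3, (∀ i, |ξ i - κ i| ≤ d / 2) → c ξ = 1) {v : L2} {S : ℝ≥0∞}
    (h : ∀ᵐ ξ, ‖c ξ • hat v ξ‖ₑ ≤ S) {ρ : ℝ} (hρ : 2 * Real.pi * ρ ≤ d / 2) :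
    ∀ᵐ y, ‖y - (2 * Real.pi)⁻¹ • κ‖ ≤ ρ → ‖fourierField v y‖ₑ ≤ S := by
  have hpi : (0 : ℝ) < 2 * Real.pi := by have := Real.pi_pos; positivity
  filter_upwards [ae_comp_smul hpi.ne' h] with y hy hyρ
  have h1 : c ((2 * Real.pi) • y) = 1 := by
    refine hc _ fun i => ?_
    have e : ((2 * Real.pi) • y) i - κ i = ((2 * Real.pi) • (y - (2 * Real.pi)⁻¹ • κ)) i := by
      simp only [PiLp.smul_apply, PiLp.sub_apply, smul_eq_mul]
      field_simp
    rw [e, ← Real.norm_eq_abs]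
    refine (PiLp.norm_apply_le _ i).trans ?_
    rw [norm_smul, Real.norm_eq_abs, abs_of_pos hpi]
    exact (mul_le_mul_of_nonneg_left hyρ hpi.le).trans hρ
  rwa [h1, one_smul, hat_eq, smul_smul, inv_mul_cancel₀ hpi.ne', one_smul] at hy

theorem IsKernel.enorm_schwartzAvg_le {y₀ : R3} {ρ L : ℝ} {g : 𝓢(R3, ℝ)}
    (hg : IsKernel y₀ ρ L g) {v : L2} {S : ℝ≥0∞}
    (h : ∀ᵐ y, ‖y - y₀‖ ≤ ρ → ‖fourierField v y‖ₑ ≤ S) : ‖schwartzAvg g v‖ₑ ≤ S := by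
  rcases eq_or_ne S ⊤ with rfl | hS
  · simp
  lift S to NNReal using hS
  have : ‖schwartzAvg g v‖ ≤ S := hg.norm_schwartzAvg_le S.2 <| by
    filter_upwards [h] with y hy hyρ
    simpa [enorm_eq_nnnorm, ← NNReal.coe_le_coe] using hy hyρ
  simpa [enorm_eq_nnnorm, ← NNReal.coe_le_coe] using this

theorem ofReal_timeNorm_sq {F : Type*} [NormedAddCommGroup F] {T : ℝ} {f : ℝ → F}
    (hf : MemLp f 2 (volume.restrict (Ioo 0 T))) :
    ENNReal.ofReal (timeNorm T f ^ 2) = ∫⁻ t in Ioo 0 T, ‖f t‖ₑ ^ 2 := by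
  rw [timeNorm_sq, ofReal_integral_eq_lintegral_ofReal (hf.integrable_norm_pow two_ne_zero)
    (Eventually.of_forall fun t => by positivity)]
  refine lintegral_congr fun t => ?_
  rw [ENNReal.ofReal_pow (norm_nonneg _)]
  simp

theorem timeNorm_sq_add_le_Finfty {χ : R3 → R3 → ℝ} {δ : R3 → ℝ} (hχ : IsCutoffFamily δ χ)
    {f₁ f₂ : ℝ → L2} {T : ℝ} (hf₁ : MemLp f₁ 2 (volume.restrict (Ioo 0 T)))
    (hf₂ : MemLp f₂ 2 (volume.restrict (Ioo 0 T))) (hF : Finfty χ f₁ f₂ T < ⊤) {κ : R3}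
    (hκ : κ ≠ 0) {ρ L : ℝ} (hρ : 2 * Real.pi * ρ ≤ δ κ / 2) {g : 𝓢(R3, ℝ)}
    (hg : IsKernel ((2 * Real.pi)⁻¹ • κ) ρ L g) :
    timeNorm T (fun t => schwartzAvg g (f₁ t)) ^ 2 + timeNorm T (fun t => schwartzAvg g (f₂ t)) ^ 2
      ≤ (Finfty χ f₁ f₂ T).toReal ^ 2 := by
  have hle : ∀ v : L2, ‖schwartzAvg g v‖ₑ ≤ eLpNorm (fun ξ => χ κ ξ • hat v ξ) ∞ volume := fun v =>
    hg.enorm_schwartzAvg_le (ae_enorm_fourierField_le (hχ.eq_one κ hκ)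
      (by rw [eLpNorm_exponent_top]; exact ae_le_eLpNormEssSup) hρ)
  have hA : ∀ {f : ℝ → L2}, MemLp f 2 (volume.restrict (Ioo 0 T)) →
      MemLp (fun t => schwartzAvg g (f t)) 2 (volume.restrict (Ioo 0 T)) := fun hf =>
    (schwartzAvg g).comp_memLp' hf
  have hle2 : ENNReal.ofReal (timeNorm T (fun t => schwartzAvg g (f₁ t)) ^ 2 +
      timeNorm T (fun t => schwartzAvg g (f₂ t)) ^ 2) ≤ Finfty χ f₁ f₂ T ^ 2 := by
    have hm : AEMeasurable (fun t => ‖schwartzAvg g (f₁ t)‖ₑ ^ 2) (volume.restrict (Ioo 0 T)) :=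
      ((schwartzAvg g).comp_memLp' hf₁).aestronglyMeasurable.enorm.pow_const 2
    rw [ENNReal.ofReal_add (sq_nonneg _) (sq_nonneg _), ofReal_timeNorm_sq (hA hf₁),
      ofReal_timeNorm_sq (hA hf₂), ← lintegral_add_left' hm]
    refine (lintegral_mono fun t => add_le_add (pow_le_pow_left₀ zero_le (hle (f₁ t)) 2)
      (pow_le_pow_left₀ zero_le (hle (f₂ t)) 2)).trans ?_
    have h1 := le_iSup (fun κ : {κ : R3 // κ ≠ 0} =>
      (∫⁻ t in Ioo 0 T, (eLpNorm (fun ξ => χ κ ξ • hat (f₁ t) ξ) ∞ volume ^ 2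
      + eLpNorm (fun ξ => χ κ ξ • hat (f₂ t) ξ) ∞ volume ^ 2)) ^ (1 / 2 : ℝ)) ⟨κ, hκ⟩
    have h2 := pow_le_pow_left₀ zero_le h1 2
    refine le_trans (le_of_eq ?_) h2
    simp only
    rw [← ENNReal.rpow_natCast, ← ENNReal.rpow_mul]
    norm_num
  have h3 := ENNReal.toReal_mono (ENNReal.pow_ne_top hF.ne) hle2
  rwa [ENNReal.toReal_ofReal (by positivity), ENNReal.toReal_pow] at h3

/-! ### Ball averages of the Fourier transform -/

/-- The average of `y ↦ v̂(2πy)` over a ball. -/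
def ballAvg (y : R3) (r : ℝ) : L2 →L[ℝ] C3 :=
  fourierAvg (indicatorConstLp 2 (measurableSet_ball (x := y) (ε := r)) measure_ball_lt_top.ne
    (volume.real (Metric.ball y r))⁻¹)

theorem ballAvg_apply (y : R3) (r : ℝ) (v : L2) :
    ballAvg y r v = ⨍ z in Metric.ball y r, fourierField v z := by
  rw [ballAvg, fourierAvg_apply, setAverage_eq, ← integral_smul, ← integral_indicator
    measurableSet_ball]
  refine integral_congr_ae ?_
  filter_upwards [indicatorConstLp_coeFn (p := 2) (μ := (volume : Measure R3))
    (hs := measurableSet_ball (x := y) (ε := r)) (hμs := measure_ball_lt_top.ne)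
    (c := (volume.real (Metric.ball y r))⁻¹)] with z hz
  rw [hz]
  by_cases h : z ∈ Metric.ball y r <;> simp [h]

open scoped Pointwise in
theorem average_hat (v : L2) (κ : R3) {s : ℝ} :
    ⨍ ξ in Metric.ball κ s, hat v ξ = ballAvg ((2 * Real.pi)⁻¹ • κ) ((2 * Real.pi)⁻¹ * s) v := by
  have hpi : (0 : ℝ) < (2 * Real.pi)⁻¹ := by have := Real.pi_pos; positivity
  have hb : (2 * Real.pi)⁻¹ • Metric.ball κ s =
      Metric.ball ((2 * Real.pi)⁻¹ • κ) ((2 * Real.pi)⁻¹ * s) := by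
    rw [smul_ball hpi.ne', Real.norm_eq_abs, abs_of_pos hpi]
  rw [ballAvg_apply, setAverage_eq, setAverage_eq, ← hb]
  simp_rw [hat_eq]
  rw [Measure.setIntegral_comp_smul_of_pos volume (fun z => fourierField v z) _ hpi, smul_smul]
  congr 1
  rw [measureReal_def, measureReal_def, Measure.addHaar_smul, ENNReal.toReal_mul,
    ENNReal.toReal_ofReal (abs_nonneg _), abs_of_pos (pow_pos hpi _), mul_comm, ← mul_inv]

theorem integrableOn_ball_fourierField (v : L2) (y : R3) (r : ℝ) :
    IntegrableOn (fourierField v) (Metric.ball y r) :=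
  (((Lp.memLp (fourierField v)).locallyIntegrable (by norm_num)).integrableOn_isCompact
    (isCompact_closedBall y r)).mono_set Metric.ball_subset_closedBall

/-- Bumps supported in the ball, with plateau radius r(n+1)/(n+2) increasing to r, are divided by
the volume of the ball. They lie below the normalised indicator, hence are kernels, and converge to
it pointwise; dominated convergence finishes. -/
theorem exists_isKernel_tendsto_ballAvg (y : R3) {r : ℝ} (hr : 0 < r) :
    ∃ g : ℕ → 𝓢(R3, ℝ), (∀ n, IsKernel y r (volume.real (Metric.ball y r))⁻¹ (g n)) ∧
      ∀ v, Tendsto (fun n => schwartzAvg (g n) v) atTop (𝓝 (ballAvg y r v)) := by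
  set V := volume.real (Metric.ball y r)
  have hV : 0 < V := ENNReal.toReal_pos (Metric.measure_ball_pos volume y hr).ne'
    measure_ball_lt_top.ne
  let c : ℕ → ContDiffBump y := fun n =>
    ⟨r * ((n + 1) / (n + 2)), r, by positivity,
      mul_lt_of_lt_one_right hr (by rw [div_lt_one (by positivity)]; linarith)⟩
  let g : ℕ → 𝓢(R3, ℝ) := fun n => V⁻¹ • (c n).hasCompactSupport.toSchwartzMap (c n).contDiff
  have hg : ∀ n z, g n z = V⁻¹ * c n z := fun n z => rfl
  have hsupp : ∀ n z, z ∉ Metric.ball y r → c n z = 0 := by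
    intro n z hz
    have : z ∉ Function.support (c n) := by rwa [(c n).support_eq]
    simpa using this
  have habs : ∀ n z, |g n z| ≤ (Metric.ball y r).indicator (fun _ => V⁻¹) z := by
    intro n z
    rw [hg, abs_mul, abs_of_pos (inv_pos.2 hV), abs_of_nonneg (c n).nonneg]
    by_cases hz : z ∈ Metric.ball y r
    · rw [indicator_of_mem hz]
      exact mul_le_of_le_one_right (inv_pos.2 hV).le (c n).le_one
    · rw [hsupp n z hz, indicator_of_notMem hz, mul_zero]
  have hind : Integrable ((Metric.ball y r).indicator fun _ => V⁻¹) :=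
    (integrable_indicator_iff measurableSet_ball).2
      (integrableOn_const measure_ball_lt_top.ne)
  refine ⟨g, fun n => ⟨fun z hz => ?_, fun z => (habs n z).trans ?_, ?_⟩, fun v => ?_⟩
  · by_contra h
    refine hz ?_
    rw [hg, hsupp n z, mul_zero]
    rw [Metric.mem_ball, dist_eq_norm]
    exact fun h' => h h'.le
  · exact indicator_le_self' (fun _ _ => (inv_pos.2 hV).le) z
  · refine (integral_mono (g n).integrable.norm hind (habs n)).trans_eq ?_
    rw [integral_indicator measurableSet_ball, setIntegral_const, smul_eq_mul]
    exact mul_inv_cancel₀ hV.ne'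
  · have hlim : ballAvg y r v =
        ∫ z, (Metric.ball y r).indicator (fun z => V⁻¹ • fourierField v z) z := by
      rw [ballAvg_apply, setAverage_eq, ← integral_smul, ← integral_indicator measurableSet_ball]
    rw [hlim]
    simp_rw [schwartzAvg_apply]
    refine tendsto_integral_of_dominated_convergence
      (fun z => ‖(Metric.ball y r).indicator (fun z => V⁻¹ • fourierField v z) z‖)
      (fun n => (g n).continuous.aestronglyMeasurable.smul (Lp.aestronglyMeasurable _)) ?_
      (fun n => Eventually.of_forall fun z => ?_) (Eventually.of_forall fun z => ?_)
    · exact ((integrable_indicator_iff measurableSet_ball).2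
        ((integrableOn_ball_fourierField v y r).smul V⁻¹)).norm
    · rw [norm_smul, Real.norm_eq_abs]
      refine (mul_le_mul_of_nonneg_right (habs n z) (norm_nonneg _)).trans ?_
      by_cases hz : z ∈ Metric.ball y r
      · simp [hz, norm_smul, abs_of_pos hV]
      · simp [hz]
    · by_cases hz : z ∈ Metric.ball y r
      · rw [indicator_of_mem hz]
        have hr' : Tendsto (fun n : ℕ => r * (((n : ℝ) + 1) / (n + 2))) atTop (𝓝 (r * 1)) := by
          refine Tendsto.const_mul r ?_
          have : Tendsto (fun n : ℕ => 1 - 1 / (((n + 1 : ℕ) : ℝ) + 1)) atTop (𝓝 (1 - 0)) :=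
            tendsto_const_nhds.sub ((tendsto_add_atTop_iff_nat 1).2
              tendsto_one_div_add_atTop_nhds_zero_nat)
          rw [sub_zero] at this
          refine this.congr fun n => ?_
          push_cast
          field_simp
          ring
        rw [mul_one] at hr'
        refine tendsto_const_nhds.congr' ?_
        filter_upwards [hr'.eventually (lt_mem_nhds (Metric.mem_ball.1 hz))] with n hn
        rw [hg, (c n).one_of_mem_closedBall (Metric.mem_closedBall.2 hn.le), mul_one]
      · rw [indicator_of_notMem hz]
        refine tendsto_const_nhds.congr fun n => ?_
        rw [hg, hsupp n z hz, mul_zero, zero_smul]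

theorem aemeasurable_enorm_sq_add {T : ℝ} {u b : ℝ → L2}
    (hu : MemLp u 2 (volume.restrict (Ioo 0 T))) (hb : MemLp b 2 (volume.restrict (Ioo 0 T)))
    (A : L2 →L[ℝ] C3) :
    AEMeasurable (fun t => ‖A (u t)‖ₑ ^ 2 + ‖A (b t)‖ₑ ^ 2) (volume.restrict (Ioo 0 T)) :=
  ((A.continuous.comp_aestronglyMeasurable hu.aestronglyMeasurable).enorm.pow_const 2).add
    ((A.continuous.comp_aestronglyMeasurable hb.aestronglyMeasurable).enorm.pow_const 2)

/-- The sharp indicator is not a Schwartz kernel; Fatou's lemma carries the bound to it. -/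
theorem lintegral_ballAvg_le {T : ℝ} {u b : ℝ → L2}
    (hu : MemLp u 2 (volume.restrict (Ioo 0 T))) (hb : MemLp b 2 (volume.restrict (Ioo 0 T)))
    {y : R3} {r M : ℝ} (hr : 0 < r)
    (h : ∀ g, IsKernel y r (volume.real (Metric.ball y r))⁻¹ g →
      pairNorm T (fun t => schwartzAvg g (u t)) (fun t => schwartzAvg g (b t)) ≤ M) :
    ∫⁻ t in Ioo 0 T, (‖ballAvg y r (u t)‖ₑ ^ 2 + ‖ballAvg y r (b t)‖ₑ ^ 2) ≤
      ENNReal.ofReal (M ^ 2) := by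
  obtain ⟨g, hg, hlim⟩ := exists_isKernel_tendsto_ballAvg y hr
  have hl : ∀ t, ‖ballAvg y r (u t)‖ₑ ^ 2 + ‖ballAvg y r (b t)‖ₑ ^ 2 =
      liminf (fun n => ‖schwartzAvg (g n) (u t)‖ₑ ^ 2 + ‖schwartzAvg (g n) (b t)‖ₑ ^ 2) atTop :=
    fun t => (Tendsto.liminf_eq ((ENNReal.Tendsto.pow (hlim (u t)).enorm).add
      (ENNReal.Tendsto.pow (hlim (b t)).enorm))).symm
  simp_rw [hl]
  refine (lintegral_liminf_le' fun n => aemeasurable_enorm_sq_add hu hb (schwartzAvg (g n))).trans ?_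
  refine liminf_le_of_frequently_le' (Frequently.of_forall fun n => ?_)
  have h1 := h (g n) (hg n)
  have hA : ∀ {f : ℝ → L2}, MemLp f 2 (volume.restrict (Ioo 0 T)) →
      MemLp (fun t => schwartzAvg (g n) (f t)) 2 (volume.restrict (Ioo 0 T)) := fun hf =>
    (schwartzAvg (g n)).comp_memLp' hf
  rw [lintegral_add_left' ((hA hu).aestronglyMeasurable.enorm.pow_const 2),
    ← ofReal_timeNorm_sq (hA hu), ← ofReal_timeNorm_sq (hA hb),
    ← ENNReal.ofReal_add (sq_nonneg _) (sq_nonneg _)]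
  refine ENNReal.ofReal_le_ofReal ?_
  exact (Real.sqrt_le_iff.1 h1).2

theorem tendsto_ballAvg_preciseRep {v : L2} {κ : R3}
    (h : ∃ l, Tendsto (fun r : ℝ => ⨍ y in Metric.ball κ r, hat v y) (𝓝[>] 0) (𝓝 l)) :
    Tendsto (fun r => ballAvg ((2 * Real.pi)⁻¹ • κ) r v) (𝓝[>] 0) (𝓝 (preciseRep (hat v) κ)) := by
  have hpi : (0 : ℝ) < 2 * Real.pi := by have := Real.pi_pos; positivity
  rw [preciseRep, dif_pos h]
  have h1 := h.choose_spec
  have h2 : Tendsto (fun r : ℝ => (2 * Real.pi) * r) (𝓝[>] 0) (𝓝[>] 0) := by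
    refine tendsto_nhdsWithin_iff.2 ⟨?_, ?_⟩
    · have : Tendsto (fun r : ℝ => (2 * Real.pi) * r) (𝓝 0) (𝓝 ((2 * Real.pi) * 0)) :=
        (continuous_const.mul continuous_id).tendsto 0
      rw [mul_zero] at this
      exact this.mono_left nhdsWithin_le_nhds
    · filter_upwards [self_mem_nhdsWithin] with r hr
      exact mul_pos hpi hr
  refine (h1.comp h2).congr fun r => ?_
  rw [Function.comp_apply, average_hat, ← mul_assoc, inv_mul_cancel₀ hpi.ne', one_mul]

/-- Where the averages have no limit the representative is 0, which is harmless in an upper bound.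
The two fields are treated separately, since one limit may exist without the other. -/
theorem enorm_preciseRep_sq_add_le (v w : L2) (κ : R3) :
    ‖preciseRep (hat v) κ‖ₑ ^ 2 + ‖preciseRep (hat w) κ‖ₑ ^ 2 ≤
      liminf (fun r => ‖ballAvg ((2 * Real.pi)⁻¹ • κ) r v‖ₑ ^ 2 +
        ‖ballAvg ((2 * Real.pi)⁻¹ • κ) r w‖ₑ ^ 2) (𝓝[>] 0) := by
  have key : ∀ v : L2, ∃ e : ℝ → ℝ≥0∞, (∀ r, e r ≤ ‖ballAvg ((2 * Real.pi)⁻¹ • κ) r v‖ₑ ^ 2) ∧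
      Tendsto e (𝓝[>] 0) (𝓝 (‖preciseRep (hat v) κ‖ₑ ^ 2)) := by
    intro v
    by_cases h : ∃ l, Tendsto (fun r : ℝ => ⨍ y in Metric.ball κ r, hat v y) (𝓝[>] 0) (𝓝 l)
    · exact ⟨_, fun r => le_rfl, ENNReal.Tendsto.pow (tendsto_ballAvg_preciseRep h).enorm⟩
    · refine ⟨fun _ => 0, fun r => zero_le, ?_⟩
      rw [preciseRep, dif_neg h]
      simp
  obtain ⟨e, he, he'⟩ := key v
  obtain ⟨e₂, he₂, he₂'⟩ := key w
  rw [← (he'.add he₂').liminf_eq]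
  exact liminf_le_liminf (Eventually.of_forall fun r => add_le_add (he r) (he₂ r))

/-! ### The bound at a fixed wave vector -/

/-- In terms of Z = β√m k² the claim reads (√2 R²/m + F/√m) Z + R₁² < Z². As R₂ is the larger root
of Z² = R₃ Z + R₁², it remains to see that the coefficient is at most R₃, which follows from √2 ≤ 2.
-/
theorem quadratic_lt_of_radius₂_lt {m k R F R₁ β : ℝ} (hm : 0 < m) (hk : 0 < k) (hF : 0 ≤ F)
    (hβ : radius₂ m R F R₁ / (√m * k ^ 2) < β) :
    (F + √2 * (R ^ 2 / √m)) * β + (R₁ / k) ^ 2 < m * k ^ 2 * β ^ 2 := by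
  have hs : 0 < √m := Real.sqrt_pos.2 hm
  have hss : √m ^ 2 = m := Real.sq_sqrt hm.le
  have h2 : √2 ≤ (2 : ℝ) := Real.sqrt_le_iff.2 (by norm_num)
  rw [div_lt_iff₀ (by positivity)] at hβ
  set Z := β * (√m * k ^ 2)
  rw [radius₂] at hβ
  set r := radius₃ m R F
  have hr0 : 0 ≤ r := by simp only [r, radius₃]; positivity
  set s := √(4 * R₁ ^ 2 + r ^ 2)
  have hs0 : 0 ≤ s := Real.sqrt_nonneg _
  have hs2 : s ^ 2 = 4 * R₁ ^ 2 + r ^ 2 := Real.sq_sqrt (by positivity)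
  have hZ0 : 0 < Z := by linarith
  have hZ : r * Z + R₁ ^ 2 < Z ^ 2 := by nlinarith
  have hr : (F + √2 * (R ^ 2 / √m)) / √m ≤ r := by
    simp only [r, radius₃]
    have e : (F + √2 * (R ^ 2 / √m)) / √m = √2 * (R ^ 2 / m) + F / √m := by
      rw [add_div, mul_div_assoc, div_div, ← sq, hss, add_comm]
    have h3 : 0 ≤ R ^ 2 / m := by positivity
    have h4 : 0 ≤ F / √m := by positivity
    rw [e, mul_div_assoc, mul_div_assoc]
    nlinarith
  have hβZ : β = Z / (√m * k ^ 2) := by simp only [Z]; field_simp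
  have e1 : (F + √2 * (R ^ 2 / √m)) * β + (R₁ / k) ^ 2 =
      ((F + √2 * (R ^ 2 / √m)) / √m * Z + R₁ ^ 2) / k ^ 2 := by
    rw [hβZ]; field_simp
  have e2 : m * k ^ 2 * β ^ 2 = Z ^ 2 / k ^ 2 := by
    change _ = (β * (√m * k ^ 2)) ^ 2 / k ^ 2
    rw [mul_pow, mul_pow, hss]; field_simp
  rw [e1, e2]
  gcongr
  exact lt_of_le_of_lt (by gcongr) hZ

/-- C/β + D/β² is nonincreasing in β, so M > β would give l - e ≤ C/M + D/M² ≤ C/β + D/β² < l - e.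
-/
theorem le_of_quadratic_lt {l e C D M β : ℝ} (hβ : 0 < β) (hC : 0 ≤ C) (hD : 0 ≤ D)
    (h₁ : C * β + D < (l - e) * β ^ 2) (h₂ : l * M ^ 2 ≤ (C + e * M) * M + D) : M ≤ β := by
  by_contra h
  rw [not_le] at h
  have h3 : (l - e) * M ^ 2 ≤ C * M + D := by linarith
  have hle : 0 < l - e := by
    by_contra hn
    nlinarith [sq_nonneg β, mul_nonneg hC hβ.le]
  have h4 : 0 ≤ C * M * β * (M - β) + D * (M ^ 2 - β ^ 2) := by
    have : 0 ≤ M ^ 2 - β ^ 2 := by nlinarith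
    have h5 : 0 ≤ M - β := by linarith
    have h6 : 0 ≤ M := by linarith
    positivity
  have h5 := mul_lt_mul_of_pos_right h₁ (by nlinarith : 0 < M ^ 2)
  have h6 := mul_le_mul_of_nonneg_right h3 (sq_nonneg β)
  nlinarith

/-- Any β above β₀ satisfies the quadratic inequality strictly, which leaves room for the error at
small radii; there M ≤ β. Fatou's lemma as r → 0 gives the bound with β, and then β decreases to β₀.
-/
theorem lintegral_preciseRep_le {ν η : ℝ} (hν : 0 < ν) (hη : 0 < η) {f₁ f₂ : ℝ → L2}
    {u₀ b₀ : L2} {u b : ℝ → L2} (hsol : IsWeakSolution ν η f₁ f₂ u₀ b₀ u b)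
    {T : ℝ} (hT : 0 < T) (hf₁ : IsLinftyL2 T f₁) (hf₂ : IsLinftyL2 T f₂) {R : ℝ} (hR0 : 0 ≤ R)
    (hR : ∀ t ∈ Ioo 0 T, ‖u t‖ ^ 2 + ‖b t‖ ^ 2 ≤ R ^ 2)
    (hRT : min ν η * (∫ s in Ioo 0 T, (gradNormSq (u s) + gradNormSq (b s))) ≤ R ^ 2)
    {δ : R3 → ℝ} {χ : R3 → R3 → ℝ} (hχ : IsCutoffFamily δ χ) {R₁ : ℝ} {κ : R3} (hκ : κ ≠ 0)
    (hR₁ : (⨆ p : {p : ℝ // 2 ≤ p}, ep χ p κ u₀ b₀) < ENNReal.ofReal (R₁ / ‖κ‖))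
    (hF : Finfty χ f₁ f₂ T < ⊤) :
    ∫⁻ t in Ioo 0 T, (‖preciseRep (hat (u t)) κ‖ₑ ^ 2 + ‖preciseRep (hat (b t)) κ‖ₑ ^ 2) ≤
      ENNReal.ofReal
        ((radius₂ (min ν η) R (Finfty χ f₁ f₂ T).toReal R₁ / (√(min ν η) * ‖κ‖ ^ 2)) ^ 2) := by
  have hk : 0 < ‖κ‖ := norm_pos_iff.2 hκ
  have hm : 0 < min ν η := lt_min hν hη
  have hpi : (0 : ℝ) < 2 * Real.pi := by have := Real.pi_pos; positivity
  set m := min ν η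
  set F := (Finfty χ f₁ f₂ T).toReal
  have hF0 : 0 ≤ F := ENNReal.toReal_nonneg
  set y₀ : R3 := (2 * Real.pi)⁻¹ • κ
  have hy : (2 * Real.pi) ^ 2 * ‖y₀‖ ^ 2 = ‖κ‖ ^ 2 := by
    rw [norm_smul, Real.norm_eq_abs, abs_of_pos (inv_pos.2 hpi)]
    field_simp
  have hy0 : 0 < ‖y₀‖ := norm_pos_iff.2 (smul_ne_zero (inv_pos.2 hpi).ne' hκ)
  have hu2 := (hsol.u_H1 T hT).1
  have hb2 := (hsol.b_H1 T hT).1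
  have ha : 0 < R₁ / ‖κ‖ := ENNReal.ofReal_pos.1 (zero_le.trans_lt hR₁)
  obtain ⟨hu₀, hb₀⟩ := ae_enorm_le_of_ep_le (hχ.smooth κ hκ).continuous
    (fun p hp => (le_iSup (fun p : {p : ℝ // 2 ≤ p} => ep χ p κ u₀ b₀) ⟨p, hp⟩).trans hR₁.le)
  have hinit : ∀ {v : L2} {r : ℝ}, (∀ᵐ ξ, ‖χ κ ξ • hat v ξ‖ₑ ≤ ENNReal.ofReal (R₁ / ‖κ‖)) →
      2 * Real.pi * r ≤ δ κ / 2 → ∀ᵐ y, ‖y - y₀‖ ≤ r → ‖fourierField v y‖ ≤ R₁ / ‖κ‖ := by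
    intro v r hv hr
    filter_upwards [ae_enorm_fourierField_le (hχ.eq_one κ hκ) hv hr] with y hy hyr
    have := hy hyr
    rwa [← ofReal_norm, ENNReal.ofReal_le_ofReal_iff ha.le] at this
  set β₀ := radius₂ m R F R₁ / (√m * ‖κ‖ ^ 2)
  have hβ₀ : 0 ≤ β₀ := by simp only [β₀, radius₂, radius₃]; positivity
  have hlim : Tendsto (fun β : ℝ => ENNReal.ofReal (β ^ 2)) (𝓝[>] β₀)
      (𝓝 (ENNReal.ofReal (β₀ ^ 2))) :=
    ((ENNReal.continuous_ofReal.comp (continuous_pow 2)).tendsto β₀).mono_left nhdsWithin_le_nhds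
  refine ge_of_tendsto hlim ?_
  filter_upwards [self_mem_nhdsWithin] with β hβ
  have hβ0 : 0 < β := hβ₀.trans_lt hβ
  have hquad := quadratic_lt_of_radius₂_lt hm hk hF0 hβ
  -- The radius is chosen after β. It must avoid the origin, fit inside the cube where the cutoff is
  -- 1, and keep the error within the strict gap.
  have hsmall : ∀ᶠ r : ℝ in 𝓝[>] 0, 0 < r ∧ r < ‖y₀‖ ∧ 2 * Real.pi * r < δ κ / 2 ∧
      (F + √2 * (R ^ 2 / √m)) * β + (R₁ / ‖κ‖) ^ 2 <
        (m * ‖κ‖ ^ 2 - max ν η * ((2 * Real.pi) ^ 2 * (3 * ‖y₀‖ * r))) * β ^ 2 := by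
    refine Eventually.and self_mem_nhdsWithin (Filter.Eventually.filter_mono nhdsWithin_le_nhds ?_)
    refine (gt_mem_nhds hy0).and (Eventually.and ?_ ?_)
    · refine ContinuousAt.eventually_lt (by fun_prop) (by fun_prop) ?_
      have := hχ.δ_pos κ hκ
      simpa using this
    · refine ContinuousAt.eventually_lt (by fun_prop) (by fun_prop) ?_
      simpa using hquad
  refine (lintegral_mono fun t => enorm_preciseRep_sq_add_le (u t) (b t) κ).trans
    ((lintegral_liminf_le' fun r => aemeasurable_enorm_sq_add hu2 hb2 (ballAvg y₀ r)).trans ?_)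
  refine liminf_le_of_frequently_le' (Eventually.frequently ?_)
  filter_upwards [hsmall] with r hr
  obtain ⟨hr0, hr1, hr2, hr3⟩ := hr
  obtain ⟨M, hM0, hM, hMq⟩ := exists_pairNorm_schwartzAvg_le
    (L := (volume.real (Metric.ball y₀ r))⁻¹) hν hη hsol hT hf₁ hf₂ hR0 hR hRT hr0 hr1 ha.le hF0
    (hinit hu₀ hr2.le) (hinit hb₀ hr2.le) (fun g hg => timeNorm_sq_add_le_Finfty hχ
      (memLp_two_of_top hf₁.1) (memLp_two_of_top hf₂.1) hF hκ hr2.le hg)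
  rw [hy] at hMq
  have hMβ : M ≤ β := le_of_quadratic_lt hβ0 (by positivity) (sq_nonneg _) hr3
    (hMq.trans_eq (by ring))
  exact (lintegral_ballAvg_le hu2 hb2 hr0 hM).trans
    (ENNReal.ofReal_le_ofReal (pow_le_pow_left₀ hM0 hMβ 2))

/-! ### Measurability of the precise representative -/

attribute [local irreducible] ballAvg

/-- The indicator of a ball depends continuously on centre and radius at every point off the
limiting sphere, which is null. Dominated convergence applies on a slightly larger ball. -/
theorem continuousAt_ballAvg (v : L2) (y₀ : R3) {r₀ : ℝ} (hr₀ : 0 < r₀) :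
    ContinuousAt (fun p : R3 × ℝ => ballAvg p.1 p.2 v) (y₀, r₀) := by
  have hvol : ∀ᶠ p : R3 × ℝ in 𝓝 (y₀, r₀), (volume.real (Metric.ball p.1 p.2))⁻¹ =
      (p.2 ^ 3 * (Real.pi * 4 / 3))⁻¹ := by
    have : ∀ᶠ p : R3 × ℝ in 𝓝 (y₀, r₀), 0 < p.2 :=
      continuousAt_const.eventually_lt continuousAt_snd hr₀
    filter_upwards [this] with p hp
    have := Real.pi_pos
    rw [measureReal_def, EuclideanSpace.volume_ball_fin_three, ← ENNReal.ofReal_pow hp.le,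
      ← ENNReal.ofReal_mul (by positivity), ENNReal.toReal_ofReal (by positivity)]
  have hc : ContinuousAt (fun p : R3 × ℝ => (volume.real (Metric.ball p.1 p.2))⁻¹) (y₀, r₀) := by
    refine ContinuousAt.congr ?_ (hvol.mono fun p hp => hp.symm)
    refine ContinuousAt.inv₀ (by fun_prop) ?_
    have := Real.pi_pos
    simp only
    positivity
  have hi : ContinuousAt (fun p : R3 × ℝ =>
      ∫ z, (Metric.ball p.1 p.2).indicator (fourierField v) z) (y₀, r₀) := by
    have hnear : ∀ᶠ p : R3 × ℝ in 𝓝 (y₀, r₀), dist p.1 y₀ + p.2 < r₀ + 1 :=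
      ContinuousAt.eventually_lt (by fun_prop) (by fun_prop) (by simp)
    refine continuousAt_of_dominated
      (bound := (Metric.ball y₀ (r₀ + 1)).indicator fun z => ‖fourierField v z‖)
      (Eventually.of_forall fun p =>
        (Lp.aestronglyMeasurable (fourierField v)).indicator measurableSet_ball) ?_
      ((integrable_indicator_iff measurableSet_ball).2
        (integrableOn_ball_fourierField v y₀ (r₀ + 1)).norm) ?_
    · filter_upwards [hnear] with p hp
      refine Eventually.of_forall fun z => ?_
      rw [norm_indicator_eq_indicator_norm]
      refine indicator_le_indicator_of_subset (fun z hz => ?_) (fun _ => norm_nonneg _) z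
      rw [Metric.mem_ball] at hz ⊢
      linarith [dist_triangle z p.1 y₀]
    · have hsph : ∀ᵐ z, z ∉ Metric.sphere y₀ r₀ :=
        measure_eq_zero_iff_ae_notMem.1 (Measure.addHaar_sphere_of_ne_zero volume y₀ hr₀.ne')
      filter_upwards [hsph] with z hz
      rcases lt_or_gt_of_ne (show dist z y₀ ≠ r₀ from hz) with h | h
      · have : ∀ᶠ p : R3 × ℝ in 𝓝 (y₀, r₀), dist z p.1 < p.2 :=
          ContinuousAt.eventually_lt (by fun_prop) (by fun_prop) h
        refine (continuousAt_const (y := fourierField v z)).congr ?_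
        filter_upwards [this] with p hp
        rw [indicator_of_mem (Metric.mem_ball.2 hp)]
      · have : ∀ᶠ p : R3 × ℝ in 𝓝 (y₀, r₀), p.2 < dist z p.1 :=
          ContinuousAt.eventually_lt (by fun_prop) (by fun_prop) h
        refine (continuousAt_const (y := (0 : C3))).congr ?_
        filter_upwards [this] with p hp
        rw [indicator_of_notMem fun h => hp.not_gt (Metric.mem_ball.1 h)]
  refine (hc.smul hi).congr (Eventually.of_forall fun p => ?_)
  change (volume.real (Metric.ball p.1 p.2))⁻¹ • _ = ballAvg p.1 p.2 v
  rw [ballAvg_apply, setAverage_eq, ← integral_indicator measurableSet_ball]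

theorem continuous_ballAvg_center (v : L2) {r c : ℝ} (hr : 0 < r) :
    Continuous fun κ : R3 => ballAvg (c • κ) r v := by
  refine continuous_iff_continuousAt.2 fun κ => ?_
  have h : Tendsto (fun κ : R3 => (c • κ, r)) (𝓝 κ) (𝓝 (c • κ, r)) :=
    Continuous.tendsto (by fun_prop) κ
  exact (continuousAt_ballAvg v (c • κ) hr).tendsto.comp h

theorem continuousAt_ballAvg_radius (v : L2) (y : R3) {r : ℝ} (hr : 0 < r) :
    ContinuousAt (fun r => ballAvg y r v) r := by
  have h : Tendsto (fun r : ℝ => (y, r)) (𝓝 r) (𝓝 (y, r)) :=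
    Continuous.tendsto (by fun_prop) r
  exact (continuousAt_ballAvg v y hr).tendsto.comp h

/-- The filter of positive rationals tending to zero. -/
def posRatZero : Filter {q : ℚ // 0 < q} := comap (fun q => ((q : ℚ) : ℝ)) (𝓝[>] 0)

instance : posRatZero.IsCountablyGenerated := by unfold posRatZero; infer_instance

instance : posRatZero.NeBot := by
  refine comap_neBot_iff.2 fun t ht => ?_
  obtain ⟨d, hd, hdt⟩ := mem_nhdsGT_iff_exists_Ioo_subset.1 ht
  obtain ⟨q, hq1, hq2⟩ := exists_rat_btwn (show (0 : ℝ) < d from hd)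
  exact ⟨⟨q, by exact_mod_cast hq1⟩, hdt ⟨hq1, hq2⟩⟩

/-- If f stayed ε away from l at some small r, continuity would give a nearby rational where it is
more than ε/2 away. -/
theorem tendsto_nhdsGT_of_posRatZero {E : Type*} [PseudoMetricSpace E] {f : ℝ → E} {l : E}
    (hf : ∀ r, 0 < r → ContinuousAt f r)
    (h : Tendsto (fun q : {q : ℚ // 0 < q} => f (q : ℚ)) posRatZero (𝓝 l)) :
    Tendsto f (𝓝[>] 0) (𝓝 l) := by
  rw [Metric.tendsto_nhds] at h ⊢
  intro ε hε
  obtain ⟨t, ht, hts⟩ := eventually_comap.1 (h (ε / 2) (half_pos hε)) |>.exists_mem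
  obtain ⟨d, hd, hdt⟩ := mem_nhdsGT_iff_exists_Ioo_subset.1 ht
  filter_upwards [Ioo_mem_nhdsGT (show (0 : ℝ) < d from hd)] with r hr
  by_contra hlt
  have h1 : ∀ᶠ s in 𝓝 r, ε / 2 < dist (f s) l :=
    continuousAt_const.eventually_lt ((hf r hr.1).dist continuousAt_const) (by linarith)
  obtain ⟨q, hq, hq'⟩ := Rat.denseRange_cast.mem_nhds (h1.and (Ioo_mem_nhds hr.1 hr.2))
  have h2 := hts _ (hdt hq') ⟨q, by exact_mod_cast hq'.1⟩ rfl
  exact absurd h2 (not_lt.2 hq.le)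

/-- By continuity in the radius, convergence of the averages can be tested on the countably many
rational radii, so the set of convergence and the limit are measurable. Each average is jointly
measurable, being continuous in the centre and measurable in the parameter. -/
theorem measurable_preciseRep {X : Type*} [MeasurableSpace X] {v : X → L2}
    (hv : StronglyMeasurable v) :
    Measurable fun p : X × R3 => preciseRep (hat (v p.1)) p.2 := by
  have hpi : (0 : ℝ) < 2 * Real.pi := by have := Real.pi_pos; positivity
  let H : {q : ℚ // 0 < q} → X × R3 → C3 := fun q p =>
    ballAvg ((2 * Real.pi)⁻¹ • p.2) ((q : ℚ) : ℝ) (v p.1)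
  have hH : ∀ q, Measurable (H q) := by
    intro q
    have hq : (0 : ℝ) < ((q : ℚ) : ℝ) := by exact_mod_cast q.2
    have : Measurable (Function.uncurry fun (κ : R3) (x : X) =>
        ballAvg ((2 * Real.pi)⁻¹ • κ) ((q : ℚ) : ℝ) (v x)) := by
      refine measurable_uncurry_of_continuous_of_measurable (fun x =>
        continuous_ballAvg_center (v x) hq) fun κ => ?_
      exact ((ballAvg _ _).continuous.comp_stronglyMeasurable hv).measurable
    exact this.comp measurable_swap
  have hE := measurableSet_exists_tendsto (l := posRatZero) hH
  set E := {p : X × R3 | ∃ c, Tendsto (fun q => H q p) posRatZero (𝓝 c)}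
  refine measurable_of_tendsto_metrizable' posRatZero
    (f := fun q => E.indicator (H q)) (fun q => (hH q).indicator hE) ?_
  refine tendsto_pi_nhds.2 fun p => ?_
  have hcont : ∀ r, 0 < r → ContinuousAt
      (fun r => ballAvg ((2 * Real.pi)⁻¹ • p.2) r (v p.1)) r := fun r hr =>
    continuousAt_ballAvg_radius (v p.1) _ hr
  have hres : Tendsto (fun q : {q : ℚ // 0 < q} => ((q : ℚ) : ℝ)) posRatZero (𝓝[>] 0) :=
    tendsto_comap
  have hscale : ∀ {c : ℝ}, 0 < c → Tendsto (fun r : ℝ => c * r) (𝓝[>] 0) (𝓝[>] 0) := by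
    intro c hc
    refine tendsto_nhdsWithin_iff.2 ⟨?_, ?_⟩
    · have : Tendsto (fun r : ℝ => c * r) (𝓝 0) (𝓝 (c * 0)) :=
        (continuous_const.mul continuous_id).tendsto 0
      rw [mul_zero] at this
      exact this.mono_left nhdsWithin_le_nhds
    · filter_upwards [self_mem_nhdsWithin] with r hr
      exact mul_pos hc hr
  by_cases hp : p ∈ E
  · obtain ⟨c, hc⟩ := id hp
    have h1 := tendsto_nhdsGT_of_posRatZero hcont hc
    have h2 : ∃ l, Tendsto (fun r : ℝ => ⨍ y in Metric.ball p.2 r, hat (v p.1) y) (𝓝[>] 0)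
        (𝓝 l) :=
      ⟨c, (h1.comp (hscale (inv_pos.2 hpi))).congr fun r => (average_hat _ _).symm⟩
    refine ((tendsto_ballAvg_preciseRep h2).comp hres).congr fun q => ?_
    rw [indicator_of_mem hp]
    rfl
  · have h2 : ¬ ∃ l, Tendsto (fun r : ℝ => ⨍ y in Metric.ball p.2 r, hat (v p.1) y) (𝓝[>] 0)
        (𝓝 l) := fun h2 => hp ⟨_, (tendsto_ballAvg_preciseRep h2).comp hres⟩
    rw [preciseRep, dif_neg h2]
    refine tendsto_const_nhds.congr fun q => ?_
    rw [indicator_of_notMem hp]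

/-! ### Integration over the sphere |ξ| = k -/

/-- Joint measurability in time and direction permits Tonelli, so the bound at each wave vector
integrates over the sphere. Replacing u and b by strongly measurable versions changes the energy
only on a null set of times. -/
theorem aemeasurable_and_lintegral_spectralEnergy_le {T k : ℝ} (hk : 0 < k) {u b : ℝ → L2}
    (hu : AEStronglyMeasurable u (volume.restrict (Ioo 0 T)))
    (hb : AEStronglyMeasurable b (volume.restrict (Ioo 0 T))) {B : ℝ≥0∞}
    (hB : ∀ κ : R3, ‖κ‖ = k → ∫⁻ t in Ioo 0 T,
      (‖preciseRep (hat (u t)) κ‖ₑ ^ 2 + ‖preciseRep (hat (b t)) κ‖ₑ ^ 2) ≤ B) :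
    AEMeasurable (fun t => spectralEnergy k (u t) (b t)) (volume.restrict (Ioo 0 T)) ∧
      ∫⁻ t in Ioo 0 T, spectralEnergy k (u t) (b t) ≤
        ENNReal.ofReal (k ^ 2) * (B * ENNReal.ofReal (4 * Real.pi)) := by
  set u' := hu.mk u
  set b' := hb.mk b
  let G : ℝ → Metric.sphere (0 : R3) 1 → ℝ≥0∞ := fun t w =>
    ‖preciseRep (hat (u' t)) (k • (w : R3))‖ₑ ^ 2 + ‖preciseRep (hat (b' t)) (k • (w : R3))‖ₑ ^ 2
  have hpr : ∀ {v : ℝ → L2}, StronglyMeasurable v → Measurable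
      fun p : ℝ × Metric.sphere (0 : R3) 1 =>
        ‖preciseRep (hat (v p.1)) (k • (p.2 : R3))‖ₑ ^ 2 := fun hv =>
    (((measurable_preciseRep hv).comp (measurable_fst.prodMk
      ((measurable_subtype_coe.comp measurable_snd).const_smul k))).enorm).pow_const 2
  have hG : Measurable (Function.uncurry G) :=
    (hpr hu.stronglyMeasurable_mk).add (hpr hb.stronglyMeasurable_mk)
  have hub : ∀ᵐ t ∂(volume.restrict (Ioo 0 T)), u t = u' t ∧ b t = b' t :=
    hu.ae_eq_mk.and hb.ae_eq_mk
  have hS : (fun t => spectralEnergy k (u t) (b t)) =ᵐ[volume.restrict (Ioo 0 T)]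
      fun t => ENNReal.ofReal (k ^ 2) * ∫⁻ w, G t w ∂(volume : Measure R3).toSphere := by
    filter_upwards [hub] with t ht
    rw [ht.1, ht.2]
    rfl
  have hGm : Measurable fun t => ∫⁻ w, G t w ∂(volume : Measure R3).toSphere :=
    hG.lintegral_prod_right'
  refine ⟨⟨_, hGm.const_mul _, hS⟩, ?_⟩
  rw [lintegral_congr_ae hS, lintegral_const_mul _ hGm, lintegral_lintegral_swap hG.aemeasurable]
  gcongr
  have hle : ∀ w : Metric.sphere (0 : R3) 1, ∫⁻ t in Ioo 0 T, G t w ≤ B := by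
    intro w
    refine le_trans (le_of_eq (lintegral_congr_ae ?_)) (hB (k • (w : R3)) ?_)
    · filter_upwards [hub] with t ht
      rw [ht.1, ht.2]
    · rw [norm_smul, norm_eq_of_mem_sphere w, mul_one, Real.norm_eq_abs, abs_of_pos hk]
  refine (lintegral_mono hle).trans_eq ?_
  -- The unit sphere has surface measure 3 · (4π/3) = 4π.
  rw [lintegral_const, Measure.toSphere_apply_univ, EuclideanSpace.volume_ball_fin_three]
  congr 1
  rw [finrank_euclideanSpace_fin, ENNReal.ofReal_one, one_pow, one_mul, ← ENNReal.ofReal_natCast,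
    ← ENNReal.ofReal_mul (by positivity)]
  congr 1
  push_cast
  ring

end MHD

end

theorem mainTheorem4
    (ν η : ℝ) (hν : 0 < ν) (hη : 0 < η)
    (f₁ f₂ : ℝ → MHD.L2) (hf₁ : MHD.IsForce f₁) (hf₂ : MHD.IsForce f₂)
    (u₀ b₀ : MHD.L2) (u b : ℝ → MHD.L2)
    (hsol : MHD.IsWeakSolution ν η f₁ f₂ u₀ b₀ u b)
    (R : ℝ → ℝ) (hR_nonneg : ∀ t, 0 ≤ t → 0 ≤ R t) (hR_mono : MonotoneOn R (Set.Ici 0))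
    (hR_init : ‖u₀‖ ^ 2 + ‖b₀‖ ^ 2 ≤ R 0 ^ 2)
    (hR : ∀ T > 0, ‖u T‖ ^ 2 + ‖b T‖ ^ 2
      + min ν η * (∫ s in (0 : ℝ)..T, (MHD.gradNormSq (u s) + MHD.gradNormSq (b s))) ≤ R T ^ 2)
    (δ : MHD.R3 → ℝ) (χ : MHD.R3 → MHD.R3 → ℝ) (hχ : MHD.IsCutoffFamily δ χ)
    (R₁ k : ℝ) (hk : 0 < k)
    (hR₁ : ∀ κ : MHD.R3, ‖κ‖ = k →
      (⨆ p : {p : ℝ // 2 ≤ p}, MHD.ep χ p κ u₀ b₀) < ENNReal.ofReal (R₁ / k))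
    (T : ℝ) (hT : 0 < T) (hF : MHD.Finfty χ f₁ f₂ T < ⊤) :
    AEMeasurable (fun t => MHD.spectralEnergy k (u t) (b t))
        (MeasureTheory.volume.restrict (Set.Ioo 0 T)) ∧
      ENNReal.ofReal (1 / T) * ∫⁻ t in Set.Ioo 0 T, MHD.spectralEnergy k (u t) (b t) ≤
        ENNReal.ofReal
          (4 * Real.pi *
              MHD.radius₂ (min ν η) (R T) (MHD.Finfty χ f₁ f₂ T).toReal R₁ ^ 2
            / (min ν η * T * k ^ 2)) := by
  have hm : 0 < min ν η := lt_min hν hη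
  have hgrad : ∀ t, 0 < t →
      0 ≤ ∫ s in (0 : ℝ)..t, (MHD.gradNormSq (u s) + MHD.gradNormSq (b s)) := fun t ht =>
    intervalIntegral.integral_nonneg ht.le fun s _ =>
      add_nonneg (MHD.gradNormSq_nonneg _) (MHD.gradNormSq_nonneg _)
  -- The dissipation is nonnegative and R is nondecreasing, so the bound at time T holds uniformly
  -- on (0,T).
  have hRt : ∀ t ∈ Ioo 0 T, ‖u t‖ ^ 2 + ‖b t‖ ^ 2 ≤ R T ^ 2 := by
    intro t ht
    have h1 := mul_nonneg hm.le (hgrad t ht.1)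
    have h2 := pow_le_pow_left₀ (hR_nonneg t ht.1.le) (hR_mono ht.1.le hT.le ht.2.le) 2
    linarith [hR t ht.1]
  have hRT : min ν η * (∫ s in Ioo 0 T, (MHD.gradNormSq (u s) + MHD.gradNormSq (b s))) ≤
      R T ^ 2 := by
    rw [← MHD.intervalIntegral_eq_Ioo hT]
    linarith [hR T hT, sq_nonneg ‖u T‖, sq_nonneg ‖b T‖]
  obtain ⟨hmeas, hle⟩ := MHD.aemeasurable_and_lintegral_spectralEnergy_le hk
    (hsol.u_H1 T hT).1.aestronglyMeasurable (hsol.b_H1 T hT).1.aestronglyMeasurable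
    (B := ENNReal.ofReal ((MHD.radius₂ (min ν η) (R T) (MHD.Finfty χ f₁ f₂ T).toReal R₁ /
      (√(min ν η) * k ^ 2)) ^ 2)) (fun κ hκ => by
      subst hκ
      exact MHD.lintegral_preciseRep_le hν hη hsol hT (hf₁ T hT) (hf₂ T hT) (hR_nonneg T hT.le)
        hRt hRT hχ (norm_pos_iff.1 hk) (hR₁ κ rfl) hF)
  -- The constant is (1/T) · k² · 4π · R₂²/(m k⁴).
  refine ⟨hmeas, (mul_le_mul_right hle _).trans_eq ?_⟩
  rw [← ENNReal.ofReal_mul (by positivity), ← ENNReal.ofReal_mul (by positivity),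
    ← ENNReal.ofReal_mul (by positivity)]
  congr 1
  rw [div_pow, mul_pow, Real.sq_sqrt hm.le]
  field_simp
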